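/- Let $N\ge 0$ and $n\ge 2$ be integers, $V=\mathbb C^N$ with its standard scalar product, and let $V^{\otimes n}$ carry the induced scalar product, the product representation of $\mathrm{SU}(N)$, and the representation of the symmetric group $S_n$ (extended to $\mathbb C[S_n]$) that permutes the tensor factors. For a standard Young tableau $\Theta$ with $m$ boxes, let $s_\Theta=\sum_h h$ be the sum over all $h\in S_m$ that preserve each row of $\Theta$, let $a_\Theta=\sum_v \mathrm{sign}(v)\,v$ be the signed sum over all $v\in S_m$ that preserve each column of $\Theta$, let $|\Theta|$ be the product of the hook lengths of the boxes of $\Theta$, and let $Y_\Theta=\frac1{|\Theta|}s_\Theta a_\Theta$ be the Young operator, regarded as an operator on $V^{\otimes m}$. Define operators $P_\Theta$ on $V^{\otimes m}$ recursively by $P_\Theta=Y_\Theta$ if $m=2$, and, for $m\ge3$, $$P_\Theta=(P_{\Theta'}\otimes 1)\,Y_\Theta\,(P_{\Theta'}\otimes 1),$$ where $\Theta'$ is the standard tableau obtained from $\Theta$ by removing the box that holds $m$. Then, for all standard tableaux $\Theta,\Phi$ with $n$ boxes: (i) $P_\Theta P_\Phi=\delta_{\Theta\Phi}P_\Theta$;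 (ii) $\operatorname{tr}P_\Theta=\operatorname{tr}Y_\Theta$; (iii) $\sum_{\Theta}P_\Theta=1$ on $V^{\otimes n}$, the sum running over all standard tableaux with $n$ boxes; (iv) $P_\Theta^\dagger=P_\Theta$. Hence $P_\Theta$ is the orthogonal projector onto an $\mathrm{SU}(N)$-invariant subspace of $V^{\otimes n}$. This subspace is irreducible if $\Theta$ has at most $N$ rows, and it is $0$ if $\Theta$ has more than $N$ rows. -/

import Mathlib

open scoped TensorProduct

noncomputable section

namespace HermitianYoung

/-- Standard Young tableaux with `n` boxes. The entries are `0, …, n - 1` (`k` stands for the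
number `k + 1`), and `pos k` is the box, as a pair (row, column), that holds `k`. -/
structure StandardTableau (n : ℕ) where
  /-- the underlying Young diagram -/
  shape : YoungDiagram
  /-- the box that holds a given number -/
  pos : Fin n → ℕ × ℕ
  pos_injective : Function.Injective pos
  mem_shape_iff : ∀ c : ℕ × ℕ, c ∈ shape ↔ ∃ k, pos k = c
  /-- entries increase from left to right within each row -/
  row_increasing : ∀ k l, (pos k).1 = (pos l).1 → (pos k).2 < (pos l).2 → k < l
  /-- entries increase from top to bottom within each column -/
  col_increasing : ∀ k l, (pos k).2 = (pos l).2 → (pos k).1 < (pos l).1 → k < l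

namespace StandardTableau

theorem ext_pos {n : ℕ} {Θ Φ : StandardTableau n} (h : Θ.pos = Φ.pos) : Θ = Φ := by
  have hs : Θ.shape = Φ.shape := by
    ext c
    simp only [YoungDiagram.mem_cells]
    rw [Θ.mem_shape_iff, Φ.mem_shape_iff, h]
  cases Θ
  cases Φ
  simp only at h hs
  subst h hs
  rfl

theorem card_shape {n : ℕ} (Θ : StandardTableau n) : Θ.shape.card = n := by
  have h : Θ.shape.cells = Finset.univ.image Θ.pos := by
    ext c
    simp [Θ.mem_shape_iff c]
  rw [YoungDiagram.card, h, Finset.card_image_of_injective _ Θ.pos_injective, Finset.card_univ,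
    Fintype.card_fin]

theorem pos_lt {n : ℕ} (Θ : StandardTableau n) (k : Fin n) :
    (Θ.pos k).1 < n ∧ (Θ.pos k).2 < n := by
  have hk : ((Θ.pos k).1, (Θ.pos k).2) ∈ Θ.shape := (Θ.mem_shape_iff _).2 ⟨k, rfl⟩
  have hc := Θ.card_shape
  rw [YoungDiagram.card] at hc
  constructor
  · refine lt_of_lt_of_le (YoungDiagram.mem_iff_lt_colLen.1 hk) ?_
    rw [YoungDiagram.colLen_eq_card]
    exact (Finset.card_le_card (Finset.filter_subset _ _)).trans hc.le
  · refine lt_of_lt_of_le (YoungDiagram.mem_iff_lt_rowLen.1 hk) ?_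
    rw [YoungDiagram.rowLen_eq_card]
    exact (Finset.card_le_card (Finset.filter_subset _ _)).trans hc.le

instance finite (n : ℕ) : Finite (StandardTableau n) := by
  let f : StandardTableau n → (Fin n → Fin n × Fin n) :=
    fun Θ k => (⟨(Θ.pos k).1, (Θ.pos_lt k).1⟩, ⟨(Θ.pos k).2, (Θ.pos_lt k).2⟩)
  refine Finite.of_injective f fun Θ Φ h => ext_pos ?_
  funext k
  have hk := congrFun h k
  simp only [f, Prod.mk.injEq, Fin.mk.injEq] at hk
  exact Prod.ext hk.1 hk.2

instance fintype (n : ℕ) : Fintype (StandardTableau n) := Fintype.ofFinite _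

instance decEq (n : ℕ) : DecidableEq (StandardTableau n) := Classical.decEq _

theorem isLowerSet_erase {n : ℕ} (Θ : StandardTableau (n + 1)) :
    IsLowerSet (Θ.shape.cells.erase (Θ.pos (Fin.last n)) : Set (ℕ × ℕ)) := by
  intro d c hcd hd
  simp only [Finset.coe_erase, Set.mem_sdiff, Finset.mem_coe, YoungDiagram.mem_cells,
    Set.mem_singleton_iff] at hd ⊢
  obtain ⟨hd, hne⟩ := hd
  refine ⟨Θ.shape.up_left_mem hcd.1 hcd.2 hd, ?_⟩
  rintro rfl
  obtain ⟨l, hl⟩ := (Θ.mem_shape_iff _).1 hd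
  obtain ⟨m, hm⟩ := (Θ.mem_shape_iff _).1
    (Θ.shape.up_left_mem hcd.1 (le_refl d.2) hd)
  rcases lt_or_eq_of_le hcd.2 with h2 | h2
  · refine absurd (Θ.row_increasing (Fin.last n) m ?_ ?_) (not_lt.2 (Fin.le_last m))
    · rw [hm]
    · rw [hm]; exact h2
  · rcases lt_or_eq_of_le hcd.1 with h1 | h1
    · refine absurd (Θ.col_increasing (Fin.last n) l ?_ ?_) (not_lt.2 (Fin.le_last l))
      · rw [hl]; exact h2
      · rw [hl]; exact h1
    · exact hne (Prod.ext h1.symm h2.symm)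

/-- The tableau `Θ'` obtained from `Θ` by removing the box with the highest number. -/
def removeLast {n : ℕ} (Θ : StandardTableau (n + 1)) : StandardTableau n where
  shape := ⟨Θ.shape.cells.erase (Θ.pos (Fin.last n)), Θ.isLowerSet_erase⟩
  pos k := Θ.pos k.castSucc
  pos_injective := Θ.pos_injective.comp (Fin.castSucc_injective n)
  mem_shape_iff c := by
    rw [YoungDiagram.mem_mk, Finset.mem_erase, YoungDiagram.mem_cells, Θ.mem_shape_iff]
    constructor
    · rintro ⟨hne, k, rfl⟩
      induction k using Fin.lastCases with
      | last => exact absurd rfl hne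
      | cast k => exact ⟨k, rfl⟩
    · rintro ⟨k, rfl⟩
      exact ⟨fun h => (Fin.castSucc_lt_last k).ne (Θ.pos_injective h), _, rfl⟩
  row_increasing k l h1 h2 := Fin.castSucc_lt_castSucc_iff.1 (Θ.row_increasing _ _ h1 h2)
  col_increasing k l h1 h2 := Fin.castSucc_lt_castSucc_iff.1 (Θ.col_increasing _ _ h1 h2)

/-- The number of rows of a tableau, i.e. the length of its first column. -/
def numRows {n : ℕ} (Θ : StandardTableau n) : ℕ := Θ.shape.colLen 0

/-- The product of the hook lengths of the boxes. For a box `c` of the diagram the two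
subtractions are the numbers of boxes to the right of `c` and below `c`. -/
def hookProduct {n : ℕ} (Θ : StandardTableau n) : ℕ :=
  ∏ c ∈ Θ.shape.cells,
    ((Θ.shape.rowLen c.1 - (c.2 + 1)) + (Θ.shape.colLen c.2 - (c.1 + 1)) + 1)

/-- The horizontal permutations: those that preserve every row of the tableau. -/
def rowPerms {n : ℕ} (Θ : StandardTableau n) : Finset (Equiv.Perm (Fin n)) :=
  Finset.univ.filter fun σ => ∀ k, (Θ.pos (σ k)).1 = (Θ.pos k).1

/-- The vertical permutations: those that preserve every column of the tableau. -/
def colPerms {n : ℕ} (Θ : StandardTableau n) : Finset (Equiv.Perm (Fin n)) :=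
  Finset.univ.filter fun σ => ∀ k, (Θ.pos (σ k)).2 = (Θ.pos k).2

/-- The row symmetrizer in the group algebra of `S_n`. -/
def rowSymmetrizer {n : ℕ} (Θ : StandardTableau n) : MonoidAlgebra ℂ (Equiv.Perm (Fin n)) :=
  ∑ σ ∈ Θ.rowPerms, MonoidAlgebra.single σ 1

/-- The column antisymmetrizer in the group algebra of `S_n`. -/
def colAntisymmetrizer {n : ℕ} (Θ : StandardTableau n) :
    MonoidAlgebra ℂ (Equiv.Perm (Fin n)) :=
  ∑ σ ∈ Θ.colPerms, MonoidAlgebra.single σ ((Equiv.Perm.sign σ : ℤ) : ℂ)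

/-- The Young operator of a standard tableau, in the group algebra of `S_n`. -/
def young {n : ℕ} (Θ : StandardTableau n) : MonoidAlgebra ℂ (Equiv.Perm (Fin n)) :=
  ((Θ.hookProduct : ℂ)⁻¹) • (Θ.rowSymmetrizer * Θ.colAntisymmetrizer)

end StandardTableau

/-- `V = ℂ^N` with its standard scalar product. -/
abbrev V (N : ℕ) : Type := EuclideanSpace ℂ (Fin N)

/-- The tensor power `V^{⊗ n}`. -/
abbrev VPow (N n : ℕ) : Type := ⨂[ℂ]^n (V N)

/-- The representation of `S_n` on `V^{⊗ n}` by permutation of the factors: the `i`-th factor is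
moved to position `σ i`. -/
def permRep (N n : ℕ) : Representation ℂ (Equiv.Perm (Fin n)) (VPow N n) where
  toFun σ := (PiTensorProduct.reindex ℂ (fun _ => V N) σ).toLinearMap
  map_one' := by
    refine PiTensorProduct.ext (MultilinearMap.ext fun v => ?_)
    simp
    rfl
  map_mul' σ τ := by
    refine PiTensorProduct.ext (MultilinearMap.ext fun v => ?_)
    simp
    rfl

/-- The product representation of `SU(N)` on `V^{⊗ n}`, `g ↦ g ⊗ ⋯ ⊗ g`. -/
def suRep (N n : ℕ) :
    Representation ℂ (Matrix.specialUnitaryGroup (Fin N) ℂ) (VPow N n) where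
  toFun g := PiTensorProduct.map fun _ : Fin n => Matrix.toEuclideanLin g.1
  map_one' := by
    refine PiTensorProduct.ext (MultilinearMap.ext fun v => ?_)
    simp
  map_mul' g h := by
    refine PiTensorProduct.ext (MultilinearMap.ext fun v => ?_)
    simp [Matrix.toLpLin_apply]

/-- The basis `e_{a_1} ⊗ ⋯ ⊗ e_{a_n}` of `V^{⊗ n}`. -/
def stdBasis (N n : ℕ) : Module.Basis (Fin n → Fin N) ℂ (VPow N n) :=
  Basis.piTensorProduct fun _ => (EuclideanSpace.basisFun (Fin N) ℂ).toBasis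

/-- The scalar product on `V^{⊗ n}` induced by that of `V`, antilinear in the first argument; see
`tensorInner_tprod`. -/
def tensorInner {N n : ℕ} (x y : VPow N n) : ℂ :=
  ∑ a, star ((stdBasis N n).repr x a) * (stdBasis N n).repr y a

theorem tensorInner_tprod {N n : ℕ} (v w : Fin n → V N) :
    tensorInner (PiTensorProduct.tprod ℂ v) (PiTensorProduct.tprod ℂ w) =
      ∏ i, inner ℂ (v i) (w i) := by
  have h : ∀ i, inner ℂ (v i) (w i) = ∑ j, star (v i j) * w i j := by
    intro i
    simp [PiLp.inner_apply, mul_comm]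
  simp only [h, Finset.prod_univ_sum, Fintype.piFinset_univ, Finset.prod_mul_distrib]
  simp [tensorInner, stdBasis, star_prod]

/-- `A` is Hermitian with respect to the scalar product of `V^{⊗ n}`. -/
def IsHermitianOp {N n : ℕ} (A : Module.End ℂ (VPow N n)) : Prop :=
  ∀ x y, tensorInner (A x) y = tensorInner x (A y)

/-- `A` is the orthogonal projector of `V^{⊗ n}` onto the subspace `U`. -/
def IsOrthogonalProjectorOnto {N n : ℕ} (A : Module.End ℂ (VPow N n))
    (U : Submodule ℂ (VPow N n)) : Prop :=
  ∀ x, A x ∈ U ∧ ∀ u ∈ U, tensorInner u (x - A x) = 0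

/-- `A ⊗ 1` on `V^{⊗ (n + 1)} = V^{⊗ n} ⊗ V`. -/
def tensorOne {N n : ℕ} (A : Module.End ℂ (VPow N n)) : Module.End ℂ (VPow N (n + 1)) :=
  (TensorPower.mulEquiv (R := ℂ) (M := V N) (n := n) (m := 1)).conj
    (TensorProduct.map A LinearMap.id)

/-- The Young operator acting on `V^{⊗ n}`. -/
def Y (N : ℕ) {n : ℕ} (Θ : StandardTableau n) : Module.End ℂ (VPow N n) :=
  (permRep N n).asAlgebraHom Θ.young

/-- The operators `P_Θ`: the Young operators for at most two boxes, and
`P_Θ = (P_{Θ'} ⊗ 1) Y_Θ (P_{Θ'} ⊗ 1)` from three boxes on. -/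
def P (N : ℕ) : {n : ℕ} → StandardTableau n → Module.End ℂ (VPow N n)
  | 0, Θ => Y N Θ
  | 1, Θ => Y N Θ
  | 2, Θ => Y N Θ
  | _ + 3, Θ => tensorOne (P N Θ.removeLast) * Y N Θ * tensorOne (P N Θ.removeLast)

end HermitianYoung

end

/-!
In the group algebra of `S_n`, with the anti-involution `∑ c_g g ↦ ∑ c̄_g g⁻¹`, let `y_Θ` be the
Young symmetrizer and `e_Θ` the Hermitian Young operator, built by `e_Θ = e_Θ' y_Θ e_Θ'`. Since
`e_Θ'` is absorbed between `a_Θ` and `s_Θ`, an induction gives `y_Θ e_Θ y_Θ = y_Θ` and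
`e_Θ y_Θ e_Θ = e_Θ`, hence equal traces. Tableaux with the same parent but different shapes are
separated by their Young symmetrizers, the others by their parents, so the `e_Θ` are orthogonal
idempotents. The regular trace of `1 - ∑ e_Θ` is `n! (1 - ∑ 1 / |Θ|)`, which vanishes because
`∑ 1 / |Θ| = 1`, and an idempotent without regular trace is `0`. Both this sum and the hook length
formula, on which the normalization of `y_Θ` rests, come from partial fraction identities for
Frobenius' expression for `1 / |Θ|`. The same separation gives `e_Θ† e_Φ = 0` for `Θ ≠ Φ`;
multiplying `∑ e_Φ = 1` by `e_Θ†` then yields `e_Θ† = e_Θ† e_Θ`, a self-adjoint element.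

For the irreducibility, `e x e ∈ ℂ e` for `e = e_Θ`, so averaging rank one operators over `S_n`
moves any nonzero vector of the image of `P_Θ` to any other one by an operator commuting with
`S_n`. Such operators are linear combinations of the operators `U ⊗ ⋯ ⊗ U` with `U` in `SU(N)`,
since a polynomial in the entries of a matrix that vanishes on the unitary matrices is zero, and a
unitary matrix is a scalar multiple of a special unitary one.
-/

noncomputable section

namespace HermitianYoung

open MonoidAlgebra

/-! ### Idempotents and signed subgroup sums in group algebras -/

section Ring

variable {R M : Type*} [Semiring R]

theorem apply_eq_apply_of_mul_mul_eq {τ : R → M} (hτ : ∀ x y, τ (x * y) = τ (y * x)) {e y : R}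
    (he : IsIdempotentElem e) (hy : IsIdempotentElem y) (hey : e * y * e = e)
    (hye : y * e * y = y) : τ e = τ y :=
  calc τ e = τ (e * (y * e)) := by rw [← mul_assoc, hey]
    _ = τ (y * e) := by rw [hτ, mul_assoc, he.eq]
    _ = τ (e * y * y) := by rw [hτ, mul_assoc, hy.eq]
    _ = τ y := by rw [hτ, ← mul_assoc, hye]

theorem isSelfAdjoint_of_sum_eq_one [StarRing R] {ι : Type*} [Fintype ι] {e : ι → R}
    (hsum : ∑ i, e i = 1) (horth : ∀ i j, i ≠ j → star (e i) * e j = 0) (i : ι) :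
    IsSelfAdjoint (e i) := by
  have h : star (e i) * e i = star (e i) := by
    rw [← Finset.sum_eq_single_of_mem i (Finset.mem_univ i) fun j _ hj => horth i j hj.symm,
      ← Finset.mul_sum, hsum, mul_one]
  have h' := congrArg star h
  rw [star_mul, star_star] at h'
  exact h.symm.trans h'

end Ring

section UnitCoeff

variable {R : Type*} [CommSemiring R] {G : Type*} [Group G]

variable (R G) in
/-- The coefficient of the neutral element, as a linear functional on the group algebra. Up to the
factor `|G|` it is the trace of the regular representation. -/
def unitCoeff : MonoidAlgebra R G →ₗ[R] R :=
  (MonoidAlgebra.basis G R).coord 1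

theorem unitCoeff_single [DecidableEq G] (g : G) (c : R) :
    unitCoeff R G (single g c) = if g = 1 then c else 0 := by
  simp [unitCoeff, MonoidAlgebra.basis, Finsupp.single_apply]

theorem unitCoeff_one : unitCoeff R G 1 = 1 := by
  classical
  rw [MonoidAlgebra.one_def, unitCoeff_single, if_pos rfl]

theorem unitCoeff_mul_comm (x y : MonoidAlgebra R G) :
    unitCoeff R G (x * y) = unitCoeff R G (y * x) := by
  classical
  induction x using MonoidAlgebra.induction_linear with
  | zero => simp
  | add a b ha hb => simp [add_mul, mul_add, ha, hb]
  | single g c =>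
    induction y using MonoidAlgebra.induction_linear with
    | zero => simp
    | add a b ha hb => simp [add_mul, mul_add, ha, hb]
    | single h d =>
      simp only [single_mul_single, unitCoeff_single, mul_comm c d, mul_eq_one_iff_eq_inv (a := g),
        mul_eq_one_iff_eq_inv' (a := h)]

end UnitCoeff

section RegularRepresentation

variable {K : Type*} [Field K] {G : Type*}

theorem finite_groupAlgebra [Finite G] : Module.Finite K (MonoidAlgebra K G) :=
  Module.Finite.of_basis (MonoidAlgebra.basis G K)

variable [Group G]

theorem trace_mulLeft [Finite G] (x : MonoidAlgebra K G) :
    LinearMap.trace K _ (LinearMap.mulLeft K x) = Nat.card G * unitCoeff K G x := by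
  classical
  have := Fintype.ofFinite G
  have h : ∀ g : G, LinearMap.toMatrix (MonoidAlgebra.basis G K) (MonoidAlgebra.basis G K)
      (LinearMap.mulLeft K x) g g = unitCoeff K G x := by
    intro g
    simp [LinearMap.toMatrix_apply, MonoidAlgebra.basis, unitCoeff]
  rw [LinearMap.trace_eq_matrix_trace K (MonoidAlgebra.basis G K), Matrix.trace]
  simp only [Matrix.diag_apply, h]
  simp

theorem isIdempotentElem_mulLeft {e : MonoidAlgebra K G} (he : IsIdempotentElem e) :
    IsIdempotentElem (LinearMap.mulLeft K e) := by
  rw [IsIdempotentElem, Module.End.mul_eq_comp, ← LinearMap.mulLeft_mul, he.eq]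

theorem card_mul_unitCoeff [Finite G] {e : MonoidAlgebra K G} (he : IsIdempotentElem e) :
    (Nat.card G : K) * unitCoeff K G e =
      Module.finrank K (LinearMap.range (LinearMap.mulLeft K e)) := by
  have := finite_groupAlgebra (K := K) (G := G)
  rw [← trace_mulLeft,
    (LinearMap.IsIdempotentElem.isProj_range _ (isIdempotentElem_mulLeft he)).trace]

theorem eq_one_of_isIdempotentElem_of_subsingleton [Subsingleton G] {e : MonoidAlgebra K G}
    (he : IsIdempotentElem e) (h0 : e ≠ 0) : e = 1 := by
  let φ := MonoidAlgebra.uniqueRingEquiv (R := K) G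
  have h := IsIdempotentElem.iff_eq_zero_or_one.1 (he.map φ)
  rwa [map_eq_zero_iff φ φ.injective, map_eq_one_iff φ φ.injective, or_iff_right h0] at h

variable [CharZero K] [Finite G]

theorem eq_zero_of_unitCoeff_eq_zero {e : MonoidAlgebra K G} (he : IsIdempotentElem e)
    (h0 : unitCoeff K G e = 0) : e = 0 := by
  have := finite_groupAlgebra (K := K) (G := G)
  have h := LinearMap.IsIdempotentElem.eq_zero_of_trace_eq_zero (isIdempotentElem_mulLeft he)
    (by rw [trace_mulLeft, h0, mul_zero])
  simpa using LinearMap.congr_fun h 1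

theorem unitCoeff_eq_zero_of_mul_self_eq_zero {x : MonoidAlgebra K G} (h : x * x = 0) :
    unitCoeff K G x = 0 := by
  have hn : IsNilpotent (LinearMap.mulLeft K x) :=
    ⟨2, by rw [pow_two, Module.End.mul_eq_comp, ← LinearMap.mulLeft_mul, h,
      LinearMap.mulLeft_zero_eq_zero]⟩
  have ht := (LinearMap.isNilpotent_trace_of_isNilpotent hn).eq_zero
  rw [trace_mulLeft] at ht
  exact (mul_eq_zero.1 ht).resolve_left (Nat.cast_ne_zero.2 Nat.card_pos.ne')

end RegularRepresentation

section Star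

variable {R : Type*} [CommSemiring R] [StarRing R] {G : Type*} [Group G]

/-- The conjugate-linear anti-involution `∑ c_g g ↦ ∑ c̄_g g⁻¹` of the group algebra; unitary
representations turn it into the Hermitian adjoint. -/
instance groupAlgebraStarRing : StarRing (MonoidAlgebra R G) where
  star := MonoidAlgebra.liftNC
    ((algebraMap R (MonoidAlgebra R G)).toAddMonoidHom.comp (starRingEnd R).toAddMonoidHom)
    fun g => single g⁻¹ 1
  star_involutive x := by
    induction x using MonoidAlgebra.induction_linear with
    | zero => simp
    | add a b ha hb => simp only [map_add, ha, hb]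
    | single g c => simp [MonoidAlgebra.liftNC_single]
  star_mul x y := by
    induction x using MonoidAlgebra.induction_linear with
    | zero => simp
    | add a b ha hb => simp only [map_add, add_mul, mul_add, ha, hb]
    | single g c =>
      induction y using MonoidAlgebra.induction_linear with
      | zero => simp
      | add a b ha hb => simp only [map_add, add_mul, mul_add, ha, hb]
      | single h d => simp [MonoidAlgebra.liftNC_single, single_mul_single, mul_comm]
  star_add := map_add _

theorem star_single (g : G) (c : R) : star (single g c) = single g⁻¹ (star c) := by
  change MonoidAlgebra.liftNC _ _ _ = _
  simp [MonoidAlgebra.liftNC_single, starRingEnd_apply]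

instance groupAlgebraStarModule : StarModule R (MonoidAlgebra R G) where
  star_smul c x := by
    induction x using MonoidAlgebra.induction_linear with
    | zero => simp
    | add a b ha hb => rw [smul_add, star_add, ha, hb, star_add, smul_add]
    | single g d => simp [star_single]

end Star

section CharSum

variable (R : Type*) [CommRing R] {G : Type*} [Group G] [Finite G]

/-- The sum of the elements of a subgroup `H`, weighted by a sign character `χ` of the whole group.
Row symmetrizers (`χ = 1`) and column antisymmetrizers (`χ = sign`) are of this form. -/
def charSum (χ : G →* ℤˣ) (H : Subgroup G) : MonoidAlgebra R G :=
  ∑ h ∈ (H : Set G).toFinite.toFinset, single h ((χ h : ℤ) : R)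

variable {R} {χ : G →* ℤˣ} {H : Subgroup G}

theorem single_mul_charSum {g : G} (hg : g ∈ H) :
    single g 1 * charSum R χ H = ((χ g : ℤ) : R) • charSum R χ H := by
  rw [charSum, Finset.mul_sum, Finset.smul_sum]
  refine Finset.sum_equiv (Equiv.mulLeft g) (fun h => by simp [H.mul_mem_cancel_left hg])
    fun h _ => ?_
  rw [Equiv.coe_mulLeft, single_mul_single, smul_single, smul_eq_mul, ← Int.cast_mul,
    ← Units.val_mul, map_mul, ← mul_assoc, Int.units_mul_self, one_mul, one_mul]

theorem charSum_mul_single {g : G} (hg : g ∈ H) :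
    charSum R χ H * single g 1 = ((χ g : ℤ) : R) • charSum R χ H := by
  rw [charSum, Finset.sum_mul, Finset.smul_sum]
  refine Finset.sum_equiv (Equiv.mulRight g) (fun h => by simp [H.mul_mem_cancel_right hg])
    fun h _ => ?_
  rw [Equiv.coe_mulRight, single_mul_single, smul_single, smul_eq_mul, ← Int.cast_mul,
    ← Units.val_mul, map_mul, mul_comm (χ h), ← mul_assoc, Int.units_mul_self, one_mul, mul_one]

theorem isSelfAdjoint_charSum [StarRing R] : IsSelfAdjoint (charSum R χ H) := by
  rw [IsSelfAdjoint, charSum, star_sum]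
  exact Finset.sum_equiv (Equiv.inv G) (by simp) (by simp [star_single])

theorem unitCoeff_charSum_mul_charSum {χ' : G →* ℤˣ} {H' : Subgroup G} (h : Disjoint H H') :
    unitCoeff R G (charSum R χ H * charSum R χ' H') = 1 := by
  classical
  rw [charSum, charSum, Finset.sum_mul_sum, map_sum]
  simp only [map_sum, single_mul_single, unitCoeff_single]
  rw [Finset.sum_eq_single_of_mem 1 (by simp [H.one_mem]),
    Finset.sum_eq_single_of_mem 1 (by simp [H'.one_mem])]
  · simp
  · intro g _ hg
    simp [hg]
  · intro g hg hg1
    refine Finset.sum_eq_zero fun g' hg' => if_neg fun hgg' => hg1 ?_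
    rw [Set.Finite.mem_toFinset, SetLike.mem_coe] at hg hg'
    exact Subgroup.disjoint_def.1 h hg (eq_inv_of_mul_eq_one_left hgg' ▸ H'.inv_mem hg')

variable {G' : Type*} [Group G'] [Finite G'] {χ' : G' →* ℤˣ} {H' : Subgroup G'} {f : G →* G'}

theorem charSum_mul_mapDomain_charSum (hχ : χ'.comp f = χ) (hH : H ≤ H'.comap f) :
    charSum R χ' H' * mapDomainRingHom R f (charSum R χ H) = Nat.card H • charSum R χ' H' := by
  subst hχ
  have h : ∀ g ∈ (H : Set G).toFinite.toFinset,
      charSum R χ' H' * single (f g) ((χ' (f g) : ℤ) : R) = charSum R χ' H' := by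
    intro g hg
    have hsingle : single (f g) ((χ' (f g) : ℤ) : R) = ((χ' (f g) : ℤ) : R) • single (f g) 1 := by
      simp
    have hfg : f g ∈ H' := hH (by simpa using hg)
    rw [hsingle, mul_smul_comm, charSum_mul_single hfg, smul_smul,
      ← Int.cast_mul, ← Units.val_mul, Int.units_mul_self, Units.val_one, Int.cast_one, one_smul]
  rw [charSum.eq_def R (χ'.comp f), map_sum, Finset.mul_sum]
  simp only [mapDomainRingHom_apply, mapDomain_single, MonoidHom.comp_apply]
  rw [Finset.sum_congr rfl h, Finset.sum_const, ← Set.ncard_eq_toFinset_card]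
  rfl

end CharSum

/-! ### Young symmetrizers -/

section FiberPerms

variable {α β γ : Type*}

/-- The group of permutations that preserve every fibre of `f`. The horizontal and the vertical
permutations of a tableau are those preserving the row and the column index of each entry. -/
def fiberPerms (f : α → β) : Subgroup (Equiv.Perm α) where
  carrier := {σ | ∀ k, f (σ k) = f k}
  one_mem' _ := rfl
  mul_mem' hσ hτ k := (hσ _).trans (hτ k)
  inv_mem' {σ} hσ k := by simpa using (hσ (σ⁻¹ k)).symm

theorem mem_fiberPerms {f : α → β} {σ : Equiv.Perm α} :
    σ ∈ fiberPerms f ↔ ∀ k, f (σ k) = f k :=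
  Iff.rfl

variable [DecidableEq α]

theorem swap_mem_fiberPerms {f : α → β} {i j : α} (h : f i = f j) :
    Equiv.swap i j ∈ fiberPerms f := by
  intro k
  rcases eq_or_ne k i with rfl | hi
  · rw [Equiv.swap_apply_left, h]
  rcases eq_or_ne k j with rfl | hj
  · rw [Equiv.swap_apply_right, h]
  · rw [Equiv.swap_apply_of_ne_of_ne hi hj]

-- Two points `i ≠ j` with `f i = f j` and `f' (g⁻¹ i) = f' (g⁻¹ j)` give a transposition that is
-- absorbed with sign `1` on the left and, after conjugation by `g`, with sign `-1` on the right.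
theorem charSum_one_mul_mul_charSum_sign_eq_zero {K : Type*} [Field K] [CharZero K] [Fintype α]
    {f : α → β} {f' : α → γ} {g : Equiv.Perm α}
    (h : ¬ Function.Injective fun i => (f i, f' (g⁻¹ i))) :
    charSum K 1 (fiberPerms f) * single g 1 * charSum K Equiv.Perm.sign (fiberPerms f') = 0 := by
  simp only [Function.Injective, Prod.mk.injEq, not_forall] at h
  obtain ⟨i, j, ⟨hf, hf'⟩, hij⟩ := h
  set A := charSum K 1 (fiberPerms f)
  set B := charSum K Equiv.Perm.sign (fiberPerms f')
  have hA : A * single (Equiv.swap i j) 1 = A := by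
    simpa using charSum_mul_single (R := K) (χ := 1) (swap_mem_fiberPerms hf)
  have hB : single (Equiv.swap (g⁻¹ i) (g⁻¹ j)) 1 * B = -B := by
    rw [single_mul_charSum (swap_mem_fiberPerms hf'),
      Equiv.Perm.sign_swap (g⁻¹.injective.ne hij), Units.val_neg, Units.val_one, Int.cast_neg,
      Int.cast_one, neg_one_smul]
  have hg : Equiv.swap i j * g = g * Equiv.swap (g⁻¹ i) (g⁻¹ j) := by
    simp [Equiv.mul_swap_eq_swap_mul]
  have hneg : A * single g 1 * B = -(A * single g 1 * B) :=
    calc A * single g 1 * B = A * single (Equiv.swap i j * g) 1 * B := by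
          nth_rewrite 1 [← hA]
          rw [mul_assoc A, single_mul_single, mul_one]
      _ = A * single g 1 * (single (Equiv.swap (g⁻¹ i) (g⁻¹ j)) 1 * B) := by
          rw [hg, ← mul_assoc, mul_assoc A (single g 1), single_mul_single, mul_one]
      _ = -(A * single g 1 * B) := by rw [hB, mul_neg]
  have htwo : (2 : K) • (A * single g 1 * B) = 0 := by
    rw [two_smul, add_eq_zero_iff_eq_neg, ← hneg]
  exact (smul_eq_zero.1 htwo).resolve_left two_ne_zero

end FiberPerms

namespace StandardTableau

variable {n : ℕ} (Θ Φ : StandardTableau n)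

/-- The group of horizontal permutations of a tableau. -/
abbrev rowGroup : Subgroup (Equiv.Perm (Fin n)) := fiberPerms fun k => (Θ.pos k).1

/-- The group of vertical permutations of a tableau. -/
abbrev colGroup : Subgroup (Equiv.Perm (Fin n)) := fiberPerms fun k => (Θ.pos k).2

theorem rowSymmetrizer_eq_charSum : Θ.rowSymmetrizer = charSum ℂ 1 Θ.rowGroup := by
  simp only [rowSymmetrizer, charSum, MonoidHom.one_apply, Units.val_one, Int.cast_one]
  exact Finset.sum_congr (by ext; simp [rowPerms, mem_fiberPerms]) fun _ _ => rfl

theorem colAntisymmetrizer_eq_charSum :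
    Θ.colAntisymmetrizer = charSum ℂ Equiv.Perm.sign Θ.colGroup :=
  Finset.sum_congr (by ext; simp [colPerms, mem_fiberPerms]) fun _ _ => rfl

theorem star_rowSymmetrizer : star Θ.rowSymmetrizer = Θ.rowSymmetrizer := by
  rw [rowSymmetrizer_eq_charSum, isSelfAdjoint_charSum.star_eq]

theorem star_colAntisymmetrizer : star Θ.colAntisymmetrizer = Θ.colAntisymmetrizer := by
  rw [colAntisymmetrizer_eq_charSum, isSelfAdjoint_charSum.star_eq]

theorem image_pos : Finset.univ.image Θ.pos = Θ.shape.cells := by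
  ext c
  simp [Θ.mem_shape_iff c]

theorem sum_pos {M : Type*} [AddCommMonoid M] (w : ℕ × ℕ → M) :
    ∑ i, w (Θ.pos i) = ∑ c ∈ Θ.shape.cells, w c := by
  rw [← image_pos, Finset.sum_image Θ.pos_injective.injOn]

theorem rowLen_eq_card_filter (k : ℕ) :
    Θ.shape.rowLen k = (Finset.univ.filter fun i => (Θ.pos i).1 = k).card := by
  rw [YoungDiagram.rowLen_eq_card, YoungDiagram.row, ← image_pos, Finset.filter_image,
    Finset.card_image_of_injective _ Θ.pos_injective]

/-- The sum of the row indices of the boxes. It is monotone for the dominance order, which it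
replaces in the comparison of shapes. -/
def rowSum : ℕ := ∑ i, (Θ.pos i).1

/-- The box in the row of the entry `i` of `Θ` and in the column of the entry `g⁻¹ i` of `Φ`, that
is, of the entry `i` of the tableau `g Φ`. -/
def crossBox (g : Equiv.Perm (Fin n)) (i : Fin n) : ℕ × ℕ := ((Θ.pos i).1, (Φ.pos (g⁻¹ i)).2)

variable {Θ Φ} {g : Equiv.Perm (Fin n)}

-- Weight the box `(r, c)` by `r` minus the length of column `c` of `Φ`: the weight is negative
-- inside the shape of `Φ` and nonnegative outside.
theorem rowSum_add_card_sdiff_le (h : Function.Injective (crossBox Θ Φ g)) :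
    Φ.rowSum + (Φ.shape.cells \ Finset.univ.image (crossBox Θ Φ g)).card ≤ Θ.rowSum := by
  set S := Finset.univ.image (crossBox Θ Φ g)
  set w : ℕ × ℕ → ℤ := fun c => c.1 - Φ.shape.colLen c.2 with hw
  have hmem (c : ℕ × ℕ) : c ∈ Φ.shape ↔ w c < 0 := by
    rw [← Prod.mk.eta (p := c), YoungDiagram.mem_iff_lt_colLen, hw, sub_neg, Nat.cast_lt]
  have hS : ∑ c ∈ S, w c = Θ.rowSum - ∑ i, (Φ.shape.colLen (Φ.pos i).2 : ℤ) := by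
    rw [Finset.sum_image h.injOn,
      ← Equiv.sum_comp g⁻¹ fun i => (Φ.shape.colLen (Φ.pos i).2 : ℤ), rowSum]
    simp [hw, crossBox]
  have hΦ : ∑ c ∈ Φ.shape.cells, w c = Φ.rowSum - ∑ i, (Φ.shape.colLen (Φ.pos i).2 : ℤ) := by
    rw [← sum_pos, rowSum]
    simp [hw]
  have houter : 0 ≤ ∑ c ∈ S \ Φ.shape.cells, w c :=
    Finset.sum_nonneg fun c hc => not_lt.1 fun hlt =>
      (Finset.mem_sdiff.1 hc).2 ((YoungDiagram.mem_cells _).2 ((hmem c).2 hlt))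
  have hinner : ∑ c ∈ Φ.shape.cells \ S, w c ≤ -(Φ.shape.cells \ S).card := by
    rw [← mul_neg_one, ← nsmul_eq_mul]
    refine Finset.sum_le_card_nsmul _ _ _ fun c hc => ?_
    have := (hmem c).1 ((YoungDiagram.mem_cells _).1 (Finset.mem_sdiff.1 hc).1)
    omega
  have hdiff := Finset.sum_sdiff_sub_sum_sdiff (s₁ := S) (s₂ := Φ.shape.cells) (f := w)
  zify
  linarith

theorem image_crossBox (h : Function.Injective (crossBox Θ Φ g)) (hle : Θ.rowSum ≤ Φ.rowSum) :
    Finset.univ.image (crossBox Θ Φ g) = Φ.shape.cells := by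
  have hcard := rowSum_add_card_sdiff_le h
  have hsub : Φ.shape.cells ⊆ Finset.univ.image (crossBox Θ Φ g) :=
    Finset.sdiff_eq_empty_iff_subset.1 (Finset.card_eq_zero.1 (by omega))
  refine (Finset.eq_of_subset_of_card_le hsub ?_).symm
  rw [Finset.card_image_of_injective _ h, Finset.card_univ, Fintype.card_fin]
  exact Φ.card_shape.ge

theorem shape_eq_of_injective_crossBox (h : Function.Injective (crossBox Θ Φ g))
    (hle : Θ.rowSum ≤ Φ.rowSum) : Θ.shape = Φ.shape := by
  have hrow (k : ℕ) : Θ.shape.rowLen k = Φ.shape.rowLen k := by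
    rw [Θ.rowLen_eq_card_filter, YoungDiagram.rowLen_eq_card, YoungDiagram.row,
      ← image_crossBox h hle, Finset.filter_image, Finset.card_image_of_injective _ h]
    rfl
  ext ⟨i, j⟩
  simp only [YoungDiagram.mem_cells, YoungDiagram.mem_iff_lt_rowLen, hrow]

theorem exists_eq_mul_of_injective_crossBox (h : Function.Injective (crossBox Θ Θ g)) :
    ∃ σ ∈ Θ.rowGroup, ∃ τ ∈ Θ.colGroup, g = σ * τ := by
  have hex (i : Fin n) : ∃ k, Θ.pos k = crossBox Θ Θ g i := by
    rw [← Θ.mem_shape_iff, ← YoungDiagram.mem_cells, ← image_crossBox h le_rfl]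
    exact Finset.mem_image_of_mem _ (Finset.mem_univ i)
  choose u hu using hex
  have hinj : Function.Injective u := fun i j hij => h (by rw [← hu, ← hu, hij])
  let σ : Equiv.Perm (Fin n) := Equiv.ofBijective u (Finite.injective_iff_bijective.1 hinj)
  have hσ (i : Fin n) : Θ.pos (σ i) = ((Θ.pos i).1, (Θ.pos (g⁻¹ i)).2) := hu i
  refine ⟨σ⁻¹, Subgroup.inv_mem _ fun k => by simp only [hσ], σ * g, fun k => ?_, by group⟩
  simp [hσ]

variable (Θ Φ)

theorem exists_rowSymmetrizer_mul_mul_colAntisymmetrizer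
    (x : MonoidAlgebra ℂ (Equiv.Perm (Fin n))) :
    ∃ c : ℂ, Θ.rowSymmetrizer * x * Θ.colAntisymmetrizer =
      c • (Θ.rowSymmetrizer * Θ.colAntisymmetrizer) := by
  rw [rowSymmetrizer_eq_charSum, colAntisymmetrizer_eq_charSum]
  induction x using MonoidAlgebra.induction_linear with
  | zero => exact ⟨0, by simp⟩
  | add x y hx hy =>
    obtain ⟨c, hc⟩ := hx
    obtain ⟨d, hd⟩ := hy
    exact ⟨c + d, by rw [mul_add, add_mul, hc, hd, add_smul]⟩
  | single g r =>
    rw [show single g r = r • single g 1 by simp, mul_smul_comm, smul_mul_assoc]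
    by_cases h : Function.Injective (crossBox Θ Θ g)
    · obtain ⟨σ, hσ, τ, hτ, rfl⟩ := exists_eq_mul_of_injective_crossBox h
      refine ⟨r * (Equiv.Perm.sign τ : ℤ), ?_⟩
      rw [← one_mul (1 : ℂ), ← single_mul_single, ← mul_assoc, charSum_mul_single hσ, mul_assoc,
        single_mul_charSum hτ, mul_smul, mul_smul_comm]
      simp
    · exact ⟨0, by rw [charSum_one_mul_mul_charSum_sign_eq_zero h, smul_zero, zero_smul]⟩

variable {Θ Φ} in
theorem rowSymmetrizer_mul_mul_colAntisymmetrizer_eq_zero (hs : Θ.shape ≠ Φ.shape)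
    (hle : Θ.rowSum ≤ Φ.rowSum) (x : MonoidAlgebra ℂ (Equiv.Perm (Fin n))) :
    Θ.rowSymmetrizer * x * Φ.colAntisymmetrizer = 0 := by
  induction x using MonoidAlgebra.induction_linear with
  | zero => simp
  | add x y hx hy => rw [mul_add, add_mul, hx, hy, add_zero]
  | single g r =>
    have h : ¬ Function.Injective (crossBox Θ Φ g) :=
      fun h => hs (shape_eq_of_injective_crossBox h hle)
    rw [show single g r = r • single g 1 by simp, mul_smul_comm, smul_mul_assoc,
      rowSymmetrizer_eq_charSum, colAntisymmetrizer_eq_charSum,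
      charSum_one_mul_mul_charSum_sign_eq_zero h, smul_zero]

/-- The Young symmetrizer without its normalizing factor. -/
def symmetrizer : MonoidAlgebra ℂ (Equiv.Perm (Fin n)) := Θ.rowSymmetrizer * Θ.colAntisymmetrizer

theorem exists_symmetrizer_mul_mul_symmetrizer (x : MonoidAlgebra ℂ (Equiv.Perm (Fin n))) :
    ∃ c : ℂ, Θ.symmetrizer * x * Θ.symmetrizer = c • Θ.symmetrizer := by
  simpa only [symmetrizer, mul_assoc] using
    Θ.exists_rowSymmetrizer_mul_mul_colAntisymmetrizer (Θ.colAntisymmetrizer * x * Θ.rowSymmetrizer)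

variable {Θ Φ} in
theorem symmetrizer_mul_mul_symmetrizer_eq_zero (hs : Θ.shape ≠ Φ.shape)
    (x : MonoidAlgebra ℂ (Equiv.Perm (Fin n))) : Θ.symmetrizer * x * Φ.symmetrizer = 0 := by
  rcases le_total Θ.rowSum Φ.rowSum with hle | hle
  · have h := rowSymmetrizer_mul_mul_colAntisymmetrizer_eq_zero hs hle
      (Θ.colAntisymmetrizer * x * Φ.rowSymmetrizer)
    simpa only [symmetrizer, mul_assoc] using h
  · have h := congrArg star
      (rowSymmetrizer_mul_mul_colAntisymmetrizer_eq_zero hs.symm hle (star x))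
    rw [star_mul, star_mul, star_star, star_rowSymmetrizer, star_colAntisymmetrizer, star_zero] at h
    calc Θ.symmetrizer * x * Φ.symmetrizer = Θ.rowSymmetrizer *
        (Θ.colAntisymmetrizer * (x * Φ.rowSymmetrizer)) * Φ.colAntisymmetrizer := by
          simp only [symmetrizer, mul_assoc]
      _ = 0 := by rw [h, mul_zero, zero_mul]

theorem disjoint_rowGroup_colGroup : Disjoint Θ.rowGroup Θ.colGroup := by
  refine Subgroup.disjoint_def.2 fun {σ} hrow hcol => Equiv.ext fun k => ?_
  exact Θ.pos_injective (Prod.ext (hrow k) (hcol k))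

theorem unitCoeff_symmetrizer : unitCoeff ℂ _ Θ.symmetrizer = 1 := by
  rw [symmetrizer, rowSymmetrizer_eq_charSum, colAntisymmetrizer_eq_charSum,
    unitCoeff_charSum_mul_charSum Θ.disjoint_rowGroup_colGroup]

theorem exists_symmetrizer_mul_self :
    ∃ c : ℂ, c ≠ 0 ∧ Θ.symmetrizer * Θ.symmetrizer = c • Θ.symmetrizer := by
  obtain ⟨c, hc⟩ := Θ.exists_symmetrizer_mul_mul_symmetrizer 1
  rw [mul_one] at hc
  refine ⟨c, ?_, hc⟩
  rintro rfl
  rw [zero_smul] at hc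
  have h := unitCoeff_eq_zero_of_mul_self_eq_zero hc
  rw [unitCoeff_symmetrizer] at h
  exact one_ne_zero h

/-- The number `c` with `s² = c s` for the Young symmetrizer `s`. It turns out to be the product of
the hook lengths. -/
def symConst : ℂ := Θ.exists_symmetrizer_mul_self.choose

theorem symConst_ne_zero : Θ.symConst ≠ 0 := Θ.exists_symmetrizer_mul_self.choose_spec.1

theorem symmetrizer_mul_self : Θ.symmetrizer * Θ.symmetrizer = Θ.symConst • Θ.symmetrizer :=
  Θ.exists_symmetrizer_mul_self.choose_spec.2

/-- The Young symmetrizer, normalized so that it is visibly idempotent. It agrees with `young`, but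
this amounts to the hook length formula. -/
def youngIdempotent : MonoidAlgebra ℂ (Equiv.Perm (Fin n)) := Θ.symConst⁻¹ • Θ.symmetrizer

theorem isIdempotentElem_youngIdempotent : IsIdempotentElem Θ.youngIdempotent := by
  rw [IsIdempotentElem, youngIdempotent, smul_mul_assoc, mul_smul_comm, symmetrizer_mul_self,
    inv_smul_smul₀ Θ.symConst_ne_zero]

theorem unitCoeff_youngIdempotent : unitCoeff ℂ _ Θ.youngIdempotent = Θ.symConst⁻¹ := by
  rw [youngIdempotent, map_smul, unitCoeff_symmetrizer, smul_eq_mul, mul_one]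

theorem youngIdempotent_ne_zero : Θ.youngIdempotent ≠ 0 := by
  intro h
  have := Θ.unitCoeff_youngIdempotent
  rw [h, map_zero] at this
  exact inv_ne_zero Θ.symConst_ne_zero this.symm

theorem exists_youngIdempotent_mul_mul_youngIdempotent
    (x : MonoidAlgebra ℂ (Equiv.Perm (Fin n))) :
    ∃ c : ℂ, Θ.youngIdempotent * x * Θ.youngIdempotent = c • Θ.youngIdempotent := by
  obtain ⟨c, hc⟩ := Θ.exists_symmetrizer_mul_mul_symmetrizer x
  refine ⟨Θ.symConst⁻¹ * c, ?_⟩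
  rw [youngIdempotent, smul_mul_assoc, smul_mul_assoc, mul_smul_comm, hc, mul_smul,
    smul_comm c Θ.symConst⁻¹]

end StandardTableau

/-! ### Partial fractions and hook lengths -/

section PartialFractions

variable {ι K : Type*} [DecidableEq ι] [Field K]

/-- The residue at `x i` of the rational function `m ↦ 1 - ∏ j ∈ s, (1 - (m - x j)⁻¹)`, for
distinct `x j`. -/
def residue (s : Finset ι) (x : ι → K) (i : ι) : K := ∏ j ∈ s.erase i, (1 - (x i - x j)⁻¹)

theorem sum_residue_mul_insert {s : Finset ι} {k : ι} (hk : k ∉ s) (x f : ι → K) :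
    ∑ i ∈ insert k s, residue (insert k s) x i * f i =
      (∏ j ∈ s, (1 - (x k - x j)⁻¹)) * f k +
        ∑ i ∈ s, residue s x i * (1 + (x k - x i)⁻¹) * f i := by
  rw [Finset.sum_insert hk, residue, Finset.erase_insert hk]
  congr 1
  refine Finset.sum_congr rfl fun i hi => ?_
  have hki : k ≠ i := (ne_of_mem_of_not_mem hi hk).symm
  rw [residue, Finset.erase_insert_of_ne hki, Finset.prod_insert
    fun h => hk (Finset.mem_of_mem_erase h), residue, mul_comm (1 - (x i - x k)⁻¹),
    ← neg_sub (x k), inv_neg, sub_neg_eq_add]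

theorem sub_ne_zero_of_injOn_insert {s : Finset ι} {k : ι} {x : ι → K} (hk : k ∉ s)
    (hx : Set.InjOn x (insert k s : Finset ι)) {i : ι} (hi : i ∈ s) : x k - x i ≠ 0 :=
  sub_ne_zero.2 fun h => ne_of_mem_of_not_mem hi hk
    (hx (by simp) (by simp [hi]) h).symm

variable {s : Finset ι} {x : ι → K}

theorem sum_residue_mul_inv (hx : Set.InjOn x s) {m : K} (hm : ∀ i ∈ s, m - x i ≠ 0) :
    ∑ i ∈ s, residue s x i * (m - x i)⁻¹ = 1 - ∏ j ∈ s, (1 - (m - x j)⁻¹) := by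
  induction s using Finset.induction_on generalizing m with
  | empty => simp
  | insert k s hk ih =>
    have hs : Set.InjOn x s := hx.mono (by simp)
    have hks i (hi : i ∈ s) := sub_ne_zero_of_injOn_insert hk hx hi
    have hmk : m - x k ≠ 0 := hm k (by simp)
    have hms : ∀ i ∈ s, m - x i ≠ 0 := fun i hi => hm i (by simp [hi])
    have hsplit : ∀ i ∈ s, residue s x i * (1 + (x k - x i)⁻¹) * (m - x i)⁻¹ =
        residue s x i * (m - x i)⁻¹ + (m - x k)⁻¹ * (residue s x i * (x k - x i)⁻¹) -
          (m - x k)⁻¹ * (residue s x i * (m - x i)⁻¹) := by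
      intro i hi
      have := hms i hi
      have := hks i hi
      have hinv : (x k - x i)⁻¹ * (m - x i)⁻¹ =
          (m - x k)⁻¹ * (x k - x i)⁻¹ - (m - x k)⁻¹ * (m - x i)⁻¹ := by
        field_simp
        ring
      linear_combination residue s x i * hinv
    rw [sum_residue_mul_insert hk, Finset.prod_insert hk, Finset.sum_congr rfl hsplit,
      Finset.sum_sub_distrib, Finset.sum_add_distrib, ← Finset.mul_sum, ← Finset.mul_sum,
      ih hs hms, ih hs hks]
    ring

theorem sum_residue (hx : Set.InjOn x s) : ∑ i ∈ s, residue s x i = s.card := by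
  induction s using Finset.induction_on with
  | empty => simp
  | insert k s hk ih =>
    have hs : Set.InjOn x s := hx.mono (by simp)
    have hinsert := sum_residue_mul_insert hk x fun _ => 1
    simp only [mul_one, mul_add, Finset.sum_add_distrib] at hinsert
    rw [hinsert, ih hs, sum_residue_mul_inv hs fun i hi => sub_ne_zero_of_injOn_insert hk hx hi,
      Finset.card_insert_of_notMem hk]
    push_cast
    ring

theorem two_mul_sum_residue_mul (hx : Set.InjOn x s) :
    2 * ∑ i ∈ s, residue s x i * x i = 2 * ∑ i ∈ s, x i - s.card * (s.card - 1) := by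
  induction s using Finset.induction_on with
  | empty => simp
  | insert k s hk ih =>
    have hs : Set.InjOn x s := hx.mono (by simp)
    have hks i (hi : i ∈ s) := sub_ne_zero_of_injOn_insert hk hx hi
    have hsplit : ∀ i ∈ s, residue s x i * (1 + (x k - x i)⁻¹) * x i =
        residue s x i * x i + x k * (residue s x i * (x k - x i)⁻¹) - residue s x i := by
      intro i hi
      have := hks i hi
      field_simp
      ring
    rw [sum_residue_mul_insert hk, Finset.sum_congr rfl hsplit, Finset.sum_sub_distrib,
      Finset.sum_add_distrib, ← Finset.mul_sum, sum_residue_mul_inv hs hks,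
      sum_residue hs, Finset.card_insert_of_notMem hk, Finset.sum_insert hk]
    push_cast
    linear_combination ih hs

end PartialFractions

section Frobenius

theorem prod_prod_Ioo_eq_mul_prod_erase {M : Type*} [CommMonoid M] {r k : ℕ} (hk : k < r)
    (F : ℕ → ℕ → M) :
    ∏ i ∈ Finset.range r, ∏ j ∈ Finset.Ioo i r, F i j =
      (∏ i ∈ (Finset.range r).erase k, ∏ j ∈ (Finset.Ioo i r).erase k, F i j) *
        ∏ j ∈ (Finset.range r).erase k, if j < k then F j k else F k j := by
  have hrow : ∀ i ∈ (Finset.range r).erase k, ∏ j ∈ Finset.Ioo i r, F i j =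
      (∏ j ∈ (Finset.Ioo i r).erase k, F i j) * if i < k then F i k else 1 := by
    intro i _
    split_ifs with hik
    · rw [Finset.prod_erase_mul _ _ (Finset.mem_Ioo.2 ⟨hik, hk⟩)]
    · rw [Finset.erase_eq_of_notMem fun h => hik (Finset.mem_Ioo.1 h).1, mul_one]
  have hrowk : ∏ j ∈ Finset.Ioo k r, F k j =
      ∏ j ∈ (Finset.range r).erase k, if j < k then 1 else F k j := by
    rw [Finset.prod_ite, Finset.prod_const_one, one_mul]
    refine Finset.prod_congr ?_ fun _ _ => rfl
    ext j
    simp only [Finset.mem_Ioo, Finset.mem_filter, Finset.mem_erase, Finset.mem_range]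
    omega
  rw [← Finset.prod_erase_mul _ _ (Finset.mem_range.2 hk), Finset.prod_congr rfl hrow, hrowk,
    Finset.prod_mul_distrib, mul_assoc, ← Finset.prod_mul_distrib]
  congr 1
  refine Finset.prod_congr rfl fun j _ => ?_
  split_ifs
  · rw [mul_one]
  · rw [one_mul]

theorem prod_sub_update {K : Type*} [Field K] {r k : ℕ} (hk : k < r) {x : ℕ → K}
    (hx : ∀ j ∈ (Finset.range r).erase k, x k - x j ≠ 0) (m : K) :
    ∏ i ∈ Finset.range r, ∏ j ∈ Finset.Ioo i r,
        (Function.update x k m i - Function.update x k m j) =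
      (∏ i ∈ Finset.range r, ∏ j ∈ Finset.Ioo i r, (x i - x j)) *
        ∏ j ∈ (Finset.range r).erase k, ((m - x j) / (x k - x j)) := by
  rw [prod_prod_Ioo_eq_mul_prod_erase hk, prod_prod_Ioo_eq_mul_prod_erase hk, mul_assoc]
  refine congrArg₂ _ ?_ ?_
  · refine Finset.prod_congr rfl fun i hi => Finset.prod_congr rfl fun j hj => ?_
    rw [Function.update_of_ne (Finset.ne_of_mem_erase hi),
      Function.update_of_ne (Finset.ne_of_mem_erase hj)]
  · rw [← Finset.prod_mul_distrib]
    refine Finset.prod_congr rfl fun j hj => ?_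
    have := hx j hj
    rw [Function.update_self, Function.update_of_ne (Finset.ne_of_mem_erase hj)]
    split_ifs
    · field_simp
      ring
    · field_simp

theorem prod_factorial_update {r k : ℕ} (hk : k < r) (l : ℕ → ℕ) (m : ℕ) :
    ∏ i ∈ Finset.range r, ((Function.update l k m i).factorial : ℚ) =
      (∏ i ∈ Finset.range r, ((l i).factorial : ℚ)) * (m.factorial / (l k).factorial) := by
  have hk' : k ∈ Finset.range r := Finset.mem_range.2 hk
  have := (l k).factorial_ne_zero
  rw [← Finset.mul_prod_erase _ _ hk', ← Finset.mul_prod_erase _ (fun i => ((l i).factorial : ℚ))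
    hk', Function.update_self]
  have herase : ∏ i ∈ (Finset.range r).erase k, ((Function.update l k m i).factorial : ℚ) =
      ∏ i ∈ (Finset.range r).erase k, ((l i).factorial : ℚ) :=
    Finset.prod_congr rfl fun i hi => by rw [Function.update_of_ne (Finset.ne_of_mem_erase hi)]
  rw [herase]
  field_simp

/-- Frobenius' expression `∏_{i < j} (l_i - l_j) / ∏_i l_i!` for the inverse of the product of the
hook lengths, in terms of the shifted row lengths `l_i`. -/
def frobenius (r : ℕ) (l : ℕ → ℕ) : ℚ :=
  (∏ i ∈ Finset.range r, ∏ j ∈ Finset.Ioo i r, ((l i : ℚ) - l j)) /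
    ∏ i ∈ Finset.range r, ((l i).factorial : ℚ)

theorem frobenius_eq_zero {r i j : ℕ} (hij : i < j) (hj : j < r) {l : ℕ → ℕ} (h : l i = l j) :
    frobenius r l = 0 := by
  have hzero : ∏ i ∈ Finset.range r, ∏ j ∈ Finset.Ioo i r, ((l i : ℚ) - l j) = 0 :=
    Finset.prod_eq_zero (Finset.mem_range.2 (hij.trans hj))
      (Finset.prod_eq_zero (Finset.mem_Ioo.2 ⟨hij, hj⟩) (by rw [h, sub_self]))
  rw [frobenius, hzero, zero_div]

variable {r k : ℕ} {l : ℕ → ℕ} (hl : Set.InjOn l (Finset.range r))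

include hl

theorem cast_sub_cast_ne_zero (hk : k < r) {j : ℕ} (hj : j ∈ (Finset.range r).erase k) :
    (l k : ℚ) - l j ≠ 0 := by
  rw [Finset.mem_erase] at hj
  exact sub_ne_zero.2 fun h =>
    hj.1 (hl hj.2 (Finset.mem_coe.2 (Finset.mem_range.2 hk)) (Nat.cast_injective h.symm))

theorem frobenius_update (hk : k < r) (m : ℕ) :
    frobenius r (Function.update l k m) = frobenius r l * (((l k).factorial / m.factorial) *
      ∏ j ∈ (Finset.range r).erase k, (((m : ℚ) - l j) / ((l k : ℚ) - l j))) := by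
  have hcast (i : ℕ) : ((Function.update l k m i : ℕ) : ℚ) =
      Function.update (fun i => (l i : ℚ)) k m i :=
    Function.apply_update (fun _ (a : ℕ) => (a : ℚ)) l k m i
  have hprod : ∏ i ∈ Finset.range r, ((l i).factorial : ℚ) ≠ 0 :=
    Finset.prod_ne_zero_iff.2 fun i _ => Nat.cast_ne_zero.2 (l i).factorial_ne_zero
  have := (l k).factorial_ne_zero
  have := m.factorial_ne_zero
  rw [frobenius, frobenius, prod_factorial_update hk]
  simp only [hcast]
  rw [prod_sub_update hk fun j hj => cast_sub_cast_ne_zero hl hk hj]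
  field_simp

theorem frobenius_update_add_one (hk : k < r) :
    frobenius r (Function.update l k (l k + 1)) = frobenius r l *
      (residue (Finset.range r) (fun i => -(l i : ℚ)) k * (1 - -(l k : ℚ))⁻¹) := by
  have hfac : ((l k).factorial : ℚ) / (l k + 1).factorial = (1 - -(l k : ℚ))⁻¹ := by
    have := (l k).factorial_ne_zero
    rw [Nat.factorial_succ, sub_neg_eq_add, add_comm (1 : ℚ)]
    push_cast
    field_simp
  rw [frobenius_update hl hk, hfac, mul_comm (residue _ _ _), residue]
  congr 2
  refine Finset.prod_congr rfl fun j hj => ?_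
  have := cast_sub_cast_ne_zero hl hk hj
  rw [neg_sub_neg, ← neg_sub (l k : ℚ), inv_neg]
  push_cast
  field_simp
  ring

theorem sum_frobenius_update_add_one (h0 : ∃ i < r, l i = 0) :
    ∑ k ∈ Finset.range r, frobenius r (Function.update l k (l k + 1)) = frobenius r l := by
  have hx : Set.InjOn (fun i => -(l i : ℚ)) (Finset.range r) := fun i hi j hj hij =>
    hl hi hj (Nat.cast_injective (neg_injective hij))
  have hne (i : ℕ) : (1 : ℚ) - -(l i : ℚ) ≠ 0 := by
    rw [sub_neg_eq_add]
    positivity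
  have hzero : ∏ j ∈ Finset.range r, (1 - ((1 : ℚ) - -(l j : ℚ))⁻¹) = 0 := by
    obtain ⟨i, hi, h⟩ := h0
    exact Finset.prod_eq_zero (Finset.mem_range.2 hi) (by simp [h])
  rw [Finset.sum_congr rfl fun k hk => frobenius_update_add_one hl (Finset.mem_range.1 hk),
    ← Finset.mul_sum, sum_residue_mul_inv hx fun i _ => hne i, hzero, sub_zero, mul_one]

theorem frobenius_update_sub_one (hk : k < r) (h0 : l k ≠ 0) :
    frobenius r (Function.update l k (l k - 1)) = frobenius r l *
      (residue (Finset.range r) (fun i => (l i : ℚ)) k * l k) := by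
  have hfac : ((l k).factorial : ℚ) / (l k - 1).factorial = l k := by
    have := (l k - 1).factorial_ne_zero
    rw [← Nat.mul_factorial_pred h0]
    push_cast
    field_simp
  rw [frobenius_update hl hk, hfac, mul_comm (l k : ℚ), residue]
  congr 2
  refine Finset.prod_congr rfl fun j hj => ?_
  have := cast_sub_cast_ne_zero hl hk hj
  rw [Nat.cast_pred (Nat.pos_of_ne_zero h0)]
  field_simp
  ring

theorem sum_frobenius_update_sub_one :
    ∑ k ∈ Finset.range r, (if l k = 0 then 0 else frobenius r (Function.update l k (l k - 1))) =
      frobenius r l * (∑ i ∈ Finset.range r, (l i : ℚ) - r * (r - 1) / 2) := by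
  have hx : Set.InjOn (fun i => (l i : ℚ)) (Finset.range r) := fun i hi j hj hij =>
    hl hi hj (Nat.cast_injective hij)
  have hsum : ∑ i ∈ Finset.range r, (l i : ℚ) - r * (r - 1) / 2 =
      ∑ i ∈ Finset.range r, residue (Finset.range r) (fun i => (l i : ℚ)) i * l i := by
    have h := two_mul_sum_residue_mul hx
    rw [Finset.card_range] at h
    linarith
  rw [hsum, Finset.mul_sum]
  refine Finset.sum_congr rfl fun k hk => ?_
  split_ifs with h0
  · rw [h0, Nat.cast_zero, mul_zero, mul_zero]
  · exact frobenius_update_sub_one hl (Finset.mem_range.1 hk) h0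

end Frobenius

section Hooks

variable (μ : YoungDiagram)

/-- The hook length of a box `c` in a Young diagram. Outside the diagram the truncated subtractions
make this a junk value. -/
def hookLength (c : ℕ × ℕ) : ℕ := (μ.rowLen c.1 - (c.2 + 1)) + (μ.colLen c.2 - (c.1 + 1)) + 1

/-- The product of the hook lengths of the boxes of a Young diagram. -/
def diagramHookProduct : ℕ := ∏ c ∈ μ.cells, hookLength μ c

/-- The row lengths of a diagram with at most `r` rows, shifted so that they become strictly
decreasing. -/
def shiftedRowLen (r i : ℕ) : ℕ := μ.rowLen i + (r - 1 - i)

variable {μ}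

theorem lt_rowLen_iff_lt_colLen {i c : ℕ} : c < μ.rowLen i ↔ i < μ.colLen c := by
  rw [← YoungDiagram.mem_iff_lt_rowLen, YoungDiagram.mem_iff_lt_colLen]

theorem rowLen_eq_zero_iff {i : ℕ} : μ.rowLen i = 0 ↔ μ.colLen 0 ≤ i := by
  rw [← not_lt, ← lt_rowLen_iff_lt_colLen, Nat.pos_iff_ne_zero, not_not]

theorem shiftedRowLen_lt {r i j : ℕ} (hij : i < j) (hj : j < r) :
    shiftedRowLen μ r j < shiftedRowLen μ r i := by
  have := μ.rowLen_anti i j hij.le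
  simp only [shiftedRowLen]
  omega

theorem injOn_shiftedRowLen (r : ℕ) : Set.InjOn (shiftedRowLen μ r) (Finset.range r) := by
  have hanti : StrictAntiOn (shiftedRowLen μ r) (Finset.range r) :=
    fun i _ j hj hij => shiftedRowLen_lt hij (by simpa using hj)
  exact hanti.injOn

theorem injOn_hookLength (i : ℕ) :
    Set.InjOn (fun c => hookLength μ (i, c)) (Finset.range (μ.rowLen i)) := by
  have hanti : StrictAntiOn (fun c => hookLength μ (i, c)) (Finset.range (μ.rowLen i)) := by
    intro c _ c' hc' hlt
    rw [Finset.mem_coe, Finset.mem_range] at hc'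
    have := μ.colLen_anti c c' hlt.le
    simp only [hookLength]
    omega
  exact hanti.injOn

theorem injOn_shiftedRowLen_sub {r i : ℕ} :
    Set.InjOn (fun j => shiftedRowLen μ r i - shiftedRowLen μ r j) (Finset.Ioo i r) := by
  have hmono : StrictMonoOn (fun j => shiftedRowLen μ r i - shiftedRowLen μ r j)
      (Finset.Ioo i r) := by
    intro j hj j' hj' hlt
    rw [Finset.coe_Ioo, Set.mem_Ioo] at hj hj'
    have := shiftedRowLen_lt (μ := μ) hlt hj'.2
    have := shiftedRowLen_lt (μ := μ) hj'.1 hj'.2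
    dsimp only
    omega
  exact hmono.injOn

theorem hookLength_ne_shiftedRowLen_sub {r i j c : ℕ} (hc : c < μ.rowLen i) (hij : i < j)
    (hj : j < r) : hookLength μ (i, c) ≠ shiftedRowLen μ r i - shiftedRowLen μ r j := by
  have := lt_rowLen_iff_lt_colLen.1 hc
  have := lt_rowLen_iff_lt_colLen (μ := μ) (i := j) (c := c)
  have := shiftedRowLen_lt (μ := μ) hij hj
  simp only [hookLength, shiftedRowLen] at *
  omega

theorem disjoint_image_hookLength {r i : ℕ} :
    Disjoint ((Finset.range (μ.rowLen i)).image fun c => hookLength μ (i, c))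
      ((Finset.Ioo i r).image fun j => shiftedRowLen μ r i - shiftedRowLen μ r j) := by
  simp only [Finset.disjoint_left, Finset.mem_image, Finset.mem_range, Finset.mem_Ioo]
  rintro _ ⟨c, hc, rfl⟩ ⟨j, hj, h⟩
  exact hookLength_ne_shiftedRowLen_sub hc hj.1 hj.2 h.symm

theorem image_hookLength_union {r i : ℕ} (hr : μ.colLen 0 ≤ r) (hi : i < r) :
    ((Finset.range (μ.rowLen i)).image fun c => hookLength μ (i, c)) ∪
        ((Finset.Ioo i r).image fun j => shiftedRowLen μ r i - shiftedRowLen μ r j) =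
      Finset.Ico 1 (shiftedRowLen μ r i + 1) := by
  refine Finset.eq_of_subset_of_card_le (Finset.union_subset ?_ ?_) ?_
  · simp only [Finset.image_subset_iff, Finset.mem_range, Finset.mem_Ico]
    intro c hc
    have := lt_rowLen_iff_lt_colLen.1 hc
    have := μ.colLen_anti 0 c (Nat.zero_le c)
    simp only [hookLength, shiftedRowLen]
    omega
  · simp only [Finset.image_subset_iff, Finset.mem_Ioo, Finset.mem_Ico]
    intro j hj
    have := shiftedRowLen_lt (μ := μ) hj.1 hj.2
    omega
  · rw [Finset.card_union_of_disjoint disjoint_image_hookLength,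
      Finset.card_image_of_injOn (injOn_hookLength i),
      Finset.card_image_of_injOn injOn_shiftedRowLen_sub]
    simp only [shiftedRowLen, Nat.card_Ico, Finset.card_range, Nat.card_Ioo]
    omega

theorem prod_hookLength_mul_prod_sub {r i : ℕ} (hr : μ.colLen 0 ≤ r) (hi : i < r) :
    (∏ c ∈ Finset.range (μ.rowLen i), hookLength μ (i, c)) *
      ∏ j ∈ Finset.Ioo i r, (shiftedRowLen μ r i - shiftedRowLen μ r j) =
    (shiftedRowLen μ r i).factorial := by
  rw [← Finset.prod_Ico_id_eq_factorial, ← image_hookLength_union hr hi,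
    Finset.prod_union disjoint_image_hookLength, Finset.prod_image (injOn_hookLength i),
    Finset.prod_image injOn_shiftedRowLen_sub]

theorem mem_cells_iff_of_colLen_le {r : ℕ} (hr : μ.colLen 0 ≤ r) (c : ℕ × ℕ) :
    c ∈ μ.cells ↔ c.1 ∈ Finset.range r ∧ c.2 ∈ Finset.range (μ.rowLen c.1) := by
  rw [YoungDiagram.mem_cells, ← Prod.mk.eta (p := c), YoungDiagram.mem_iff_lt_rowLen,
    Finset.mem_range, Finset.mem_range, iff_and_self]
  intro h
  have := (rowLen_eq_zero_iff (μ := μ) (i := c.1)).2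
  omega

theorem inv_diagramHookProduct {r : ℕ} (hr : μ.colLen 0 ≤ r) :
    (diagramHookProduct μ : ℚ)⁻¹ = frobenius r (shiftedRowLen μ r) := by
  have hprod : ∏ i ∈ Finset.range r, ((shiftedRowLen μ r i).factorial : ℚ) =
      diagramHookProduct μ * ∏ i ∈ Finset.range r, ∏ j ∈ Finset.Ioo i r,
        ((shiftedRowLen μ r i : ℚ) - shiftedRowLen μ r j) := by
    rw [diagramHookProduct, Finset.prod_finset_product μ.cells (Finset.range r)
      (fun i => Finset.range (μ.rowLen i)) (mem_cells_iff_of_colLen_le hr),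
      Nat.cast_prod, ← Finset.prod_mul_distrib]
    refine Finset.prod_congr rfl fun i hi => ?_
    rw [← prod_hookLength_mul_prod_sub hr (Finset.mem_range.1 hi), Nat.cast_mul,
      Nat.cast_prod _ (Finset.Ioo i r)]
    congr 1
    refine Finset.prod_congr rfl fun j hj => ?_
    rw [Finset.mem_Ioo] at hj
    rw [Nat.cast_sub (shiftedRowLen_lt hj.1 hj.2).le]
  have hne : ∏ i ∈ Finset.range r, ((shiftedRowLen μ r i).factorial : ℚ) ≠ 0 :=
    Finset.prod_ne_zero_iff.2 fun i _ => Nat.cast_ne_zero.2 (Nat.factorial_ne_zero _)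
  rw [hprod] at hne
  rw [frobenius, hprod, div_mul_cancel_right₀ (right_ne_zero_of_mul hne)]

theorem card_eq_sum_rowLen {r : ℕ} (hr : μ.colLen 0 ≤ r) :
    μ.card = ∑ i ∈ Finset.range r, μ.rowLen i := by
  rw [YoungDiagram.card, Finset.card_eq_sum_ones,
    Finset.sum_finset_product μ.cells (Finset.range r)
      (fun i => Finset.range (μ.rowLen i)) (mem_cells_iff_of_colLen_le hr)]
  simp

theorem sum_shiftedRowLen {r : ℕ} (hr : μ.colLen 0 ≤ r) :
    ∑ i ∈ Finset.range r, (shiftedRowLen μ r i : ℚ) - r * (r - 1) / 2 = μ.card := by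
  have hshift : ∑ i ∈ Finset.range r, ((r - 1 - i : ℕ) : ℚ) = r * (r - 1) / 2 := by
    rw [← Nat.cast_sum, Finset.sum_range_reflect (fun i => i) r, Finset.sum_range_id,
      ← Nat.choose_two_right, Nat.cast_choose_two]
  simp only [shiftedRowLen, Nat.cast_add, Finset.sum_add_distrib, hshift]
  rw [card_eq_sum_rowLen hr, Nat.cast_sum, add_sub_cancel_right]

end Hooks

/-! ### Branching and the hook length formula -/

/-- The Young diagram `μ` arises from `ν` by adding the box `c`. -/
structure AddsBox (ν μ : YoungDiagram) (c : ℕ × ℕ) : Prop where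
  notMem : c ∉ ν
  mem_iff : ∀ d, d ∈ μ ↔ d = c ∨ d ∈ ν

namespace AddsBox

variable {ν ν' μ : YoungDiagram} {c : ℕ × ℕ}

theorem left_unique (h : AddsBox ν μ c) (h' : AddsBox ν' μ c) : ν = ν' := by
  have hmem {ν : YoungDiagram} (h : AddsBox ν μ c) (d : ℕ × ℕ) : d ∈ ν ↔ d ≠ c ∧ d ∈ μ := by
    rw [h.mem_iff]
    exact ⟨fun hd => ⟨ne_of_mem_of_not_mem hd h.notMem, Or.inr hd⟩,
      fun hd => hd.2.resolve_left hd.1⟩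
  ext d
  rw [YoungDiagram.mem_cells, YoungDiagram.mem_cells, hmem h, hmem h']

theorem card_eq (h : AddsBox ν μ c) : μ.card = ν.card + 1 := by
  have hcells : μ.cells = insert c ν.cells := by
    ext d
    simp [h.mem_iff]
  rw [YoungDiagram.card, hcells, Finset.card_insert_of_notMem (by simp [h.notMem])]

theorem snd_eq (h : AddsBox ν μ c) : c.2 = ν.rowLen c.1 := by
  have hle : ν.rowLen c.1 ≤ c.2 := not_lt.1 (YoungDiagram.mem_iff_lt_rowLen.not.1 h.notMem)
  have hmem : (c.1, ν.rowLen c.1) ∈ μ := μ.up_left_mem le_rfl hle ((h.mem_iff c).2 (Or.inl rfl))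
  rcases (h.mem_iff _).1 hmem with hc | hν
  · exact congrArg Prod.snd hc.symm
  · exact absurd (YoungDiagram.mem_iff_lt_rowLen.1 hν) (lt_irrefl _)

theorem rowLen_eq (h : AddsBox ν μ c) :
    μ.rowLen = Function.update ν.rowLen c.1 (ν.rowLen c.1 + 1) := by
  funext i
  refine eq_of_forall_lt_iff fun j => ?_
  rw [← YoungDiagram.mem_iff_lt_rowLen, h.mem_iff, Prod.ext_iff, YoungDiagram.mem_iff_lt_rowLen]
  have := h.snd_eq
  rcases eq_or_ne i c.1 with rfl | hi
  · rw [Function.update_self]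
    dsimp only
    omega
  · simp [hi]

theorem shiftedRowLen_eq (h : AddsBox ν μ c) (r : ℕ) :
    shiftedRowLen μ r =
      Function.update (shiftedRowLen ν r) c.1 (shiftedRowLen ν r c.1 + 1) := by
  funext i
  rw [shiftedRowLen, h.rowLen_eq]
  rcases eq_or_ne i c.1 with rfl | hi
  · rw [Function.update_self, Function.update_self, shiftedRowLen, add_right_comm]
  · rw [Function.update_of_ne hi, Function.update_of_ne hi, shiftedRowLen]

theorem shiftedRowLen_eq_pred (h : AddsBox ν μ c) (r : ℕ) :
    shiftedRowLen ν r =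
      Function.update (shiftedRowLen μ r) c.1 (shiftedRowLen μ r c.1 - 1) := by
  simp [h.shiftedRowLen_eq r]

end AddsBox

theorem exists_addsBox_of_forall_rowLen_lt {ν : YoungDiagram} {k : ℕ}
    (h : ∀ j < k, ν.rowLen k < ν.rowLen j) : ∃ μ, AddsBox ν μ (k, ν.rowLen k) := by
  have hlower : IsLowerSet (insert (k, ν.rowLen k) ν.cells : Set (ℕ × ℕ)) := by
    rintro ⟨i, j⟩ ⟨i', j'⟩ hle hmem
    simp only [Set.mem_insert_iff, Prod.mk.injEq, Finset.mem_coe, YoungDiagram.mem_cells,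
      YoungDiagram.mem_iff_lt_rowLen] at hmem ⊢
    have hi : i' ≤ i := hle.1
    have hj : j' ≤ j := hle.2
    have hanti := ν.rowLen_anti i' i hi
    rcases hmem with ⟨rfl, rfl⟩ | hmem
    · rcases hi.lt_or_eq with hlt | rfl
      · exact Or.inr (hj.trans_lt (h _ hlt))
      · omega
    · exact Or.inr (by omega)
  refine ⟨⟨insert (k, ν.rowLen k) ν.cells, by simpa using hlower⟩, ?_, fun d => ?_⟩
  · simp [YoungDiagram.mem_iff_lt_rowLen]
  · simp [YoungDiagram.mem_mk]

theorem exists_addsBox_of_rowLen_lt {μ : YoungDiagram} {k : ℕ}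
    (h : μ.rowLen (k + 1) < μ.rowLen k) : ∃ ν, AddsBox ν μ (k, μ.rowLen k - 1) := by
  have hlower : IsLowerSet (μ.cells.erase (k, μ.rowLen k - 1) : Set (ℕ × ℕ)) := by
    rintro ⟨i, j⟩ ⟨i', j'⟩ hle hmem
    simp only [Finset.coe_erase, Set.mem_sdiff, Finset.mem_coe, YoungDiagram.mem_cells,
      Set.mem_singleton_iff, Prod.mk.injEq] at hmem ⊢
    refine ⟨μ.up_left_mem hle.1 hle.2 hmem.1, ?_⟩
    rintro ⟨rfl, rfl⟩
    have hj := YoungDiagram.mem_iff_lt_rowLen.1 hmem.1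
    have hle1 : i' ≤ i := hle.1
    have hle2 : μ.rowLen i' - 1 ≤ j := hle.2
    rcases hle1.lt_or_eq with hlt | rfl
    · have := μ.rowLen_anti (i' + 1) i hlt
      omega
    · exact hmem.2 ⟨rfl, by omega⟩
  have hmem : (k, μ.rowLen k - 1) ∈ μ := YoungDiagram.mem_iff_lt_rowLen.2 (by omega)
  refine ⟨⟨_, hlower⟩, ?_, fun d => ?_⟩
  · simp [YoungDiagram.mem_mk]
  · rcases eq_or_ne d (k, μ.rowLen k - 1) with rfl | hd
    · simp [hmem]
    · simp [YoungDiagram.mem_mk, hd]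

theorem colLen_le_card (μ : YoungDiagram) (j : ℕ) : μ.colLen j ≤ μ.card := by
  rw [YoungDiagram.colLen_eq_card]
  exact Finset.card_le_card (Finset.filter_subset _ _)

theorem frobenius_update_add_one_eq_zero {ν : YoungDiagram} {r k : ℕ} (hk : k < r)
    (h : ¬ ∀ j < k, ν.rowLen k < ν.rowLen j) :
    frobenius r (Function.update (shiftedRowLen ν r) k (shiftedRowLen ν r k + 1)) = 0 := by
  push Not at h
  obtain ⟨j, hj, hle⟩ := h
  have := ν.rowLen_anti j (k - 1) (by omega)
  have := ν.rowLen_anti (k - 1) k (by omega)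
  refine frobenius_eq_zero (i := k - 1) (j := k) (by omega) hk ?_
  rw [Function.update_of_ne (by omega), Function.update_self, shiftedRowLen, shiftedRowLen]
  omega

theorem frobenius_update_sub_one_eq_zero {μ : YoungDiagram} {r k : ℕ} (hr : μ.colLen 0 ≤ r)
    (h : ¬ μ.rowLen (k + 1) < μ.rowLen k) (h0 : shiftedRowLen μ r k ≠ 0) :
    frobenius r (Function.update (shiftedRowLen μ r) k (shiftedRowLen μ r k - 1)) = 0 := by
  have := μ.rowLen_anti k (k + 1) k.le_succ
  have hzero := (rowLen_eq_zero_iff (μ := μ) (i := k + 1)).2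
  simp only [shiftedRowLen] at h0
  refine frobenius_eq_zero (i := k) (j := k + 1) (by omega) (by omega) ?_
  rw [Function.update_self, Function.update_of_ne (by omega), shiftedRowLen, shiftedRowLen]
  omega

namespace StandardTableau

variable {n : ℕ}

theorem addsBox_removeLast (Θ : StandardTableau (n + 1)) :
    AddsBox Θ.removeLast.shape Θ.shape (Θ.pos (Fin.last n)) where
  notMem := by simp [removeLast, YoungDiagram.mem_mk]
  mem_iff d := by
    rcases eq_or_ne d (Θ.pos (Fin.last n)) with rfl | hd
    · simp [Θ.mem_shape_iff]
    · simp [removeLast, YoungDiagram.mem_mk, hd]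

theorem eq_of_removeLast_eq {Θ Φ : StandardTableau (n + 1)} (h : Θ.removeLast = Φ.removeLast)
    (hlast : Θ.pos (Fin.last n) = Φ.pos (Fin.last n)) : Θ = Φ := by
  refine ext_pos (funext fun k => ?_)
  induction k using Fin.lastCases with
  | last => exact hlast
  | cast k => exact congrArg (fun Ψ : StandardTableau n => Ψ.pos k) h

theorem eq_of_removeLast_eq_of_row_eq {Θ Φ : StandardTableau (n + 1)}
    (h : Θ.removeLast = Φ.removeLast)
    (hrow : (Θ.pos (Fin.last n)).1 = (Φ.pos (Fin.last n)).1) : Θ = Φ :=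
  eq_of_removeLast_eq h (Prod.ext hrow (by
    rw [Θ.addsBox_removeLast.snd_eq, Φ.addsBox_removeLast.snd_eq, h, hrow]))

theorem eq_of_removeLast_eq_of_shape_eq {Θ Φ : StandardTableau (n + 1)}
    (h : Θ.removeLast = Φ.removeLast) (hs : Θ.shape = Φ.shape) : Θ = Φ := by
  have hmem : Θ.pos (Fin.last n) ∈ Φ.shape := hs ▸ (Θ.mem_shape_iff _).2 ⟨_, rfl⟩
  refine eq_of_removeLast_eq h ((Φ.addsBox_removeLast.mem_iff _).1 hmem |>.resolve_right ?_)
  exact h ▸ Θ.addsBox_removeLast.notMem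

/-- The tableau obtained by putting the next number into a further box. -/
def extend (Θ : StandardTableau n) {μ : YoungDiagram} {c : ℕ × ℕ} (h : AddsBox Θ.shape μ c) :
    StandardTableau (n + 1) where
  shape := μ
  pos := Fin.snoc (α := fun _ => ℕ × ℕ) Θ.pos c
  pos_injective := Fin.snoc_injective_iff.2 ⟨Θ.pos_injective, fun ⟨k, hk⟩ =>
    h.notMem ((Θ.mem_shape_iff c).2 ⟨k, hk⟩)⟩
  mem_shape_iff d := by
    rw [h.mem_iff, Θ.mem_shape_iff, Fin.exists_fin_succ']
    simp [eq_comm, or_comm]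
  row_increasing k l := by
    have hc (k : Fin n) (h1 : c.1 = (Θ.pos k).1) : ¬ c.2 < (Θ.pos k).2 := fun h2 =>
      h.notMem (Θ.shape.up_left_mem h1.le h2.le ((Θ.mem_shape_iff _).2 ⟨k, rfl⟩))
    cases k using Fin.lastCases <;> cases l using Fin.lastCases
    case cast.cast => simpa using Θ.row_increasing _ _
    all_goals simp +contextual [hc, Fin.castSucc_lt_last]
  col_increasing k l := by
    have hc (k : Fin n) (h1 : c.2 = (Θ.pos k).2) : ¬ c.1 < (Θ.pos k).1 := fun h2 =>
      h.notMem (Θ.shape.up_left_mem h2.le h1.le ((Θ.mem_shape_iff _).2 ⟨k, rfl⟩))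
    cases k using Fin.lastCases <;> cases l using Fin.lastCases
    case cast.cast => simpa using Θ.col_increasing _ _
    all_goals simp +contextual [hc, Fin.castSucc_lt_last]

theorem removeLast_extend (Θ : StandardTableau n) {μ : YoungDiagram} {c : ℕ × ℕ}
    (h : AddsBox Θ.shape μ c) : (Θ.extend h).removeLast = Θ :=
  ext_pos (funext fun k => by simp [removeLast, extend])

theorem pos_last_extend (Θ : StandardTableau n) {μ : YoungDiagram} {c : ℕ × ℕ}
    (h : AddsBox Θ.shape μ c) : (Θ.extend h).pos (Fin.last n) = c := by
  simp [extend]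

theorem inv_hookProduct (Θ : StandardTableau n) {r : ℕ} (hr : n ≤ r) :
    (Θ.hookProduct : ℚ)⁻¹ = frobenius r (shiftedRowLen Θ.shape r) :=
  inv_diagramHookProduct ((colLen_le_card _ _).trans (Θ.card_shape.trans_le hr))

theorem sum_inv_hookProduct_fiber (Θ : StandardTableau n) :
    ∑ Φ : StandardTableau (n + 1) with Φ.removeLast = Θ, (Φ.hookProduct : ℚ)⁻¹ =
      (Θ.hookProduct : ℚ)⁻¹ := by
  set l := shiftedRowLen Θ.shape (n + 1) with hl
  have hzero : ∃ i < n + 1, l i = 0 := by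
    refine ⟨n, n.lt_succ_self, ?_⟩
    rw [hl, shiftedRowLen, rowLen_eq_zero_iff.2 ((colLen_le_card _ _).trans_eq Θ.card_shape)]
    omega
  rw [Θ.inv_hookProduct n.le_succ, ← hl,
    ← sum_frobenius_update_add_one (injOn_shiftedRowLen _) hzero]
  refine Finset.sum_of_injOn (fun Φ => (Φ.pos (Fin.last n)).1) ?_ ?_ ?_ ?_
  · intro Φ hΦ Ψ hΨ h
    rw [Finset.mem_coe, Finset.mem_filter_univ] at hΦ hΨ
    exact eq_of_removeLast_eq_of_row_eq (hΦ.trans hΨ.symm) h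
  · exact fun Φ _ => Finset.mem_coe.2 (Finset.mem_range.2 (Φ.pos_lt _).1)
  · intro k hk hk'
    refine frobenius_update_add_one_eq_zero (Finset.mem_range.1 hk) fun hadd => hk' ?_
    obtain ⟨μ, hμ⟩ := exists_addsBox_of_forall_rowLen_lt hadd
    exact ⟨Θ.extend hμ, by simp [removeLast_extend], by simp only [pos_last_extend]⟩
  · intro Φ hΦ
    rw [Finset.mem_filter_univ] at hΦ
    rw [Φ.inv_hookProduct le_rfl, Φ.addsBox_removeLast.shiftedRowLen_eq, hΦ]

/-- The empty tableau. -/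
def empty : StandardTableau 0 where
  shape := ⊥
  pos := Fin.elim0
  pos_injective k := k.elim0
  mem_shape_iff c := by simp
  row_increasing k := k.elim0
  col_increasing k := k.elim0

instance uniqueZero : Unique (StandardTableau 0) where
  default := empty
  uniq _ := ext_pos (funext fun k => k.elim0)

theorem sum_inv_hookProduct (n : ℕ) : ∑ Θ : StandardTableau n, (Θ.hookProduct : ℚ)⁻¹ = 1 := by
  induction n with
  | zero =>
    rw [Fintype.sum_subsingleton _ empty]
    simp [hookProduct, empty]
  | succ n ih =>
    rw [← ih, ← Finset.sum_fiberwise (s := Finset.univ) (g := removeLast)]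
    exact Finset.sum_congr rfl fun Θ _ => Θ.sum_inv_hookProduct_fiber

theorem pos_last_eq {Θ : StandardTableau (n + 1)} {k : ℕ} (hk : (Θ.pos (Fin.last n)).1 = k) :
    Θ.pos (Fin.last n) = (k, Θ.shape.rowLen k - 1) := by
  subst hk
  refine Prod.ext rfl ?_
  rw [Θ.addsBox_removeLast.snd_eq, Θ.addsBox_removeLast.rowLen_eq, Function.update_self,
    Nat.add_sub_cancel]

theorem rowLen_succ_lt_of_pos_last {Θ : StandardTableau (n + 1)} {k : ℕ}
    (hk : (Θ.pos (Fin.last n)).1 = k) : Θ.shape.rowLen (k + 1) < Θ.shape.rowLen k := by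
  subst hk
  rw [Θ.addsBox_removeLast.rowLen_eq, Function.update_self, Function.update_of_ne (by omega)]
  exact Nat.lt_succ_of_le (YoungDiagram.rowLen_anti _ _ _ (Nat.le_succ _))

open scoped Classical in
/-- The set of standard tableaux of a given shape. -/
def ofShape (n : ℕ) (μ : YoungDiagram) : Finset (StandardTableau n) :=
  Finset.univ.filter fun Θ => Θ.shape = μ

theorem mem_ofShape {Θ : StandardTableau n} {μ : YoungDiagram} :
    Θ ∈ ofShape n μ ↔ Θ.shape = μ := by
  classical
  exact Finset.mem_filter_univ Θ

theorem card_filter_ofShape_row {ν μ : YoungDiagram} {k : ℕ}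
    (h : AddsBox ν μ (k, μ.rowLen k - 1)) :
    ((ofShape (n + 1) μ).filter fun Θ => (Θ.pos (Fin.last n)).1 = k).card =
      (ofShape n ν).card := by
  refine Finset.card_bij (fun Θ _ => Θ.removeLast) ?_ ?_ ?_ <;>
    simp only [Finset.mem_filter, mem_ofShape]
  · rintro Θ ⟨rfl, hk⟩
    have hΘ := Θ.addsBox_removeLast
    rw [pos_last_eq hk] at hΘ
    exact hΘ.left_unique h
  · rintro Θ ⟨-, hΘk⟩ Φ ⟨-, hΦk⟩ hΘΦ
    exact eq_of_removeLast_eq_of_row_eq hΘΦ (hΘk.trans hΦk.symm)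
  · rintro Φ rfl
    exact ⟨Φ.extend h, ⟨rfl, by rw [pos_last_extend]⟩, Φ.removeLast_extend h⟩

theorem filter_ofShape_row_eq_empty {μ : YoungDiagram} {k : ℕ}
    (h : ¬ μ.rowLen (k + 1) < μ.rowLen k) :
    ((ofShape (n + 1) μ).filter fun Θ => (Θ.pos (Fin.last n)).1 = k) = ∅ := by
  rw [Finset.filter_eq_empty_iff]
  intro Θ hΘ hk
  rw [← mem_ofShape.1 hΘ] at h
  exact h (rowLen_succ_lt_of_pos_last hk)

theorem card_ofShape {μ : YoungDiagram} (hμ : μ.card = n) :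
    ((ofShape n μ).card : ℚ) = n.factorial * (diagramHookProduct μ : ℚ)⁻¹ := by
  induction n generalizing μ with
  | zero =>
    have hbot : μ = ⊥ := by
      ext c
      rw [Finset.card_eq_zero.1 hμ, YoungDiagram.cells_bot]
    have huniv : ofShape 0 μ = {empty} := by
      rw [Finset.eq_singleton_iff_unique_mem, mem_ofShape]
      exact ⟨hbot.symm, fun Θ _ => Subsingleton.elim _ _⟩
    rw [huniv, hbot]
    simp [diagramHookProduct]
  | succ n ih =>
    have hr : μ.colLen 0 ≤ n + 1 := (colLen_le_card μ 0).trans hμ.le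
    have hrow : ∀ Θ ∈ ofShape (n + 1) μ, (Θ.pos (Fin.last n)).1 ∈ Finset.range (n + 1) :=
      fun Θ _ => Finset.mem_range.2 (Θ.pos_lt _).1
    have hsum := sum_frobenius_update_sub_one (injOn_shiftedRowLen (μ := μ) (n + 1))
    rw [sum_shiftedRowLen hr, hμ, ← inv_diagramHookProduct hr] at hsum
    rw [Nat.factorial_succ, mul_comm (n + 1), Nat.cast_mul, mul_assoc, mul_comm ((n + 1 : ℕ) : ℚ),
      ← hsum, Finset.mul_sum, Finset.card_eq_sum_card_fiberwise hrow, Nat.cast_sum]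
    refine Finset.sum_congr rfl fun k _ => ?_
    by_cases hrem : μ.rowLen (k + 1) < μ.rowLen k
    · obtain ⟨ν, hν⟩ := exists_addsBox_of_rowLen_lt hrem
      have hνcard : ν.card = n := by
        have := hν.card_eq
        omega
      have hlk : shiftedRowLen μ (n + 1) k ≠ 0 := by
        rw [shiftedRowLen]
        omega
      rw [card_filter_ofShape_row hν, ih hνcard, if_neg hlk, ← hν.shiftedRowLen_eq_pred,
        inv_diagramHookProduct (r := n + 1) ((colLen_le_card ν 0).trans (by omega))]
    · rw [filter_ofShape_row_eq_empty hrem, Finset.card_empty, Nat.cast_zero, eq_comm]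
      split_ifs with h0
      · rw [mul_zero]
      · rw [frobenius_update_sub_one_eq_zero hr hrem h0, mul_zero]

end StandardTableau

/-! ### Hermitian Young operators in the group algebra -/

section ExtendPerm

variable {n : ℕ}

variable (n) in
/-- The embedding of `S_n` into `S_{n+1}` as the stabilizer of the last point. -/
def extendPerm : Equiv.Perm (Fin n) →* Equiv.Perm (Fin (n + 1)) :=
  Equiv.Perm.viaEmbeddingHom Fin.castSuccEmb

theorem extendPerm_castSucc (σ : Equiv.Perm (Fin n)) (k : Fin n) :
    extendPerm n σ k.castSucc = (σ k).castSucc :=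
  Equiv.Perm.viaEmbedding_apply σ Fin.castSuccEmb k

theorem extendPerm_last (σ : Equiv.Perm (Fin n)) : extendPerm n σ (Fin.last n) = Fin.last n := by
  refine Equiv.Perm.viaEmbedding_apply_of_notMem σ Fin.castSuccEmb _ ?_
  rintro ⟨k, hk⟩
  exact (Fin.castSucc_lt_last k).ne hk

theorem sign_comp_extendPerm : Equiv.Perm.sign.comp (extendPerm n) = Equiv.Perm.sign := by
  refine MonoidHom.ext fun σ => ?_
  change Equiv.Perm.sign (extendPerm n σ) = Equiv.Perm.sign σ
  exact @Equiv.Perm.sign_extendDomain _ _ _ _ _ _ σ _ (fun a => Classical.propDecidable _)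
    (Equiv.ofInjective _ Fin.castSuccEmb.injective)

theorem fiberPerms_le_comap_extendPerm {β : Type*} (f : Fin (n + 1) → β) :
    (fiberPerms fun k : Fin n => f k.castSucc) ≤ (fiberPerms f).comap (extendPerm n) := by
  intro σ hσ k
  induction k using Fin.lastCases with
  | last => rw [extendPerm_last]
  | cast k =>
    rw [extendPerm_castSucc]
    exact hσ k

variable (n) in
/-- The embedding of group algebras induced by `extendPerm`. -/
def extendAlg :
    MonoidAlgebra ℂ (Equiv.Perm (Fin n)) →ₐ[ℂ] MonoidAlgebra ℂ (Equiv.Perm (Fin (n + 1))) :=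
  MonoidAlgebra.mapDomainAlgHom ℂ ℂ (extendPerm n)

theorem extendAlg_single (σ : Equiv.Perm (Fin n)) (c : ℂ) :
    extendAlg n (single σ c) = single (extendPerm n σ) c := by
  simp [extendAlg]

theorem star_extendAlg (x : MonoidAlgebra ℂ (Equiv.Perm (Fin n))) :
    star (extendAlg n x) = extendAlg n (star x) := by
  induction x using MonoidAlgebra.induction_linear with
  | zero => simp
  | add x y hx hy => simp [hx, hy]
  | single σ c => simp [extendAlg_single, star_single]

end ExtendPerm

theorem linearIndependent_of_mul_eq_self {K A ι : Type*} [Field K] [Ring A] [Algebra K A]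
    [Finite ι] {e v : ι → A} (he : OrthogonalIdempotents e) (hve : ∀ i, v i * e i = v i)
    (hv : ∀ i, v i ≠ 0) : LinearIndependent K v := by
  classical
  have := Fintype.ofFinite ι
  refine Fintype.linearIndependent_iff.2 fun c hc i => ?_
  have hmul (j : ι) : v j * e i = if j = i then v j else 0 := by
    rw [← hve j, mul_assoc, he.mul_eq]
    split_ifs <;> simp
  have h := congrArg (· * e i) hc
  simp only [Finset.sum_mul, smul_mul_assoc, hmul, smul_ite, smul_zero, Finset.sum_ite_eq',
    Finset.mem_univ, if_true, zero_mul] at h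
  exact (smul_eq_zero.1 h).resolve_right (hv i)

theorem single_mul_charSum_eq_charSum_mul_single {R G : Type*} [CommRing R] [Group G] [Finite G]
    {χ : G →* ℤˣ} {H H' : Subgroup G} {g : G} (h : ∀ σ, g * σ * g⁻¹ ∈ H' ↔ σ ∈ H) :
    single g 1 * charSum R χ H = charSum R χ H' * single g 1 := by
  rw [charSum, charSum, Finset.mul_sum, Finset.sum_mul]
  refine Finset.sum_equiv (MulAut.conj g).toEquiv (fun σ => by simp [h]) fun σ _ => ?_
  simp [single_mul_single, mul_right_comm]

theorem conj_mem_fiberPerms_iff {α β : Type*} {f f' : α → β} {g : Equiv.Perm α}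
    (hg : ∀ k, f' (g k) = f k) (σ : Equiv.Perm α) :
    g * σ * g⁻¹ ∈ fiberPerms f' ↔ σ ∈ fiberPerms f := by
  rw [mem_fiberPerms, mem_fiberPerms, g.surjective.forall]
  simp [hg]

namespace StandardTableau

variable {n : ℕ}

theorem rowSymmetrizer_mul_extendAlg (Θ : StandardTableau (n + 1)) :
    Θ.rowSymmetrizer * extendAlg n Θ.removeLast.rowSymmetrizer =
      Nat.card Θ.removeLast.rowGroup • Θ.rowSymmetrizer := by
  rw [rowSymmetrizer_eq_charSum, rowSymmetrizer_eq_charSum]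
  exact charSum_mul_mapDomain_charSum rfl
    (fiberPerms_le_comap_extendPerm fun k => (Θ.pos k).1)

theorem colAntisymmetrizer_mul_extendAlg (Θ : StandardTableau (n + 1)) :
    Θ.colAntisymmetrizer * extendAlg n Θ.removeLast.colAntisymmetrizer =
      Nat.card Θ.removeLast.colGroup • Θ.colAntisymmetrizer := by
  rw [colAntisymmetrizer_eq_charSum, colAntisymmetrizer_eq_charSum]
  exact charSum_mul_mapDomain_charSum sign_comp_extendPerm
    (fiberPerms_le_comap_extendPerm fun k => (Θ.pos k).2)

theorem extendAlg_mul_rowSymmetrizer (Θ : StandardTableau (n + 1)) :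
    extendAlg n Θ.removeLast.rowSymmetrizer * Θ.rowSymmetrizer =
      Nat.card Θ.removeLast.rowGroup • Θ.rowSymmetrizer := by
  simpa only [star_mul, star_extendAlg, star_rowSymmetrizer, star_nsmul] using
    congrArg star Θ.rowSymmetrizer_mul_extendAlg

theorem colAntisymmetrizer_mul_extendAlg_mul_rowSymmetrizer (Θ : StandardTableau (n + 1))
    (x : MonoidAlgebra ℂ (Equiv.Perm (Fin n))) :
    Θ.colAntisymmetrizer * extendAlg n (Θ.removeLast.colAntisymmetrizer * x *
        Θ.removeLast.rowSymmetrizer) * Θ.rowSymmetrizer =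
      (Nat.card Θ.removeLast.colGroup * Nat.card Θ.removeLast.rowGroup) •
        (Θ.colAntisymmetrizer * extendAlg n x * Θ.rowSymmetrizer) :=
  calc _ = Θ.colAntisymmetrizer * extendAlg n Θ.removeLast.colAntisymmetrizer * extendAlg n x *
        (extendAlg n Θ.removeLast.rowSymmetrizer * Θ.rowSymmetrizer) := by
        simp only [map_mul, mul_assoc]
    _ = _ := by
        rw [colAntisymmetrizer_mul_extendAlg, extendAlg_mul_rowSymmetrizer, smul_mul_assoc,
          smul_mul_assoc, mul_smul_comm, smul_smul]

theorem colAntisymmetrizer_mul_extendAlg_mul_rowSymmetrizer_eq {Θ : StandardTableau (n + 1)}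
    {x : MonoidAlgebra ℂ (Equiv.Perm (Fin n))}
    (h : Θ.removeLast.colAntisymmetrizer * x * Θ.removeLast.rowSymmetrizer =
      Θ.removeLast.colAntisymmetrizer * Θ.removeLast.rowSymmetrizer) :
    Θ.colAntisymmetrizer * extendAlg n x * Θ.rowSymmetrizer =
      Θ.colAntisymmetrizer * Θ.rowSymmetrizer := by
  have hcard : Nat.card Θ.removeLast.colGroup * Nat.card Θ.removeLast.rowGroup ≠ 0 :=
    mul_ne_zero Nat.card_pos.ne' Nat.card_pos.ne'
  refine smul_right_injective _ hcard ?_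
  have hone := Θ.colAntisymmetrizer_mul_extendAlg_mul_rowSymmetrizer 1
  rw [mul_one, map_one, mul_one] at hone
  simp only [← Θ.colAntisymmetrizer_mul_extendAlg_mul_rowSymmetrizer, h, hone]

theorem star_symmetrizer (Θ : StandardTableau n) :
    star Θ.symmetrizer = Θ.colAntisymmetrizer * Θ.rowSymmetrizer := by
  rw [symmetrizer, star_mul, star_rowSymmetrizer, star_colAntisymmetrizer]

theorem star_symmetrizer_mul_self (Θ : StandardTableau n) :
    star Θ.symmetrizer * star Θ.symmetrizer = star Θ.symConst • star Θ.symmetrizer := by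
  rw [← star_mul, symmetrizer_mul_self, star_smul]

theorem star_symConst (Θ : StandardTableau n) : star Θ.symConst = Θ.symConst := by
  have hstar : unitCoeff ℂ _ (star Θ.symmetrizer) = 1 := by
    rw [star_symmetrizer, unitCoeff_mul_comm, ← symmetrizer, unitCoeff_symmetrizer]
  calc star Θ.symConst = unitCoeff ℂ _ (star Θ.symmetrizer * star Θ.symmetrizer) := by
        rw [star_symmetrizer_mul_self, map_smul, hstar, smul_eq_mul, mul_one]
    _ = unitCoeff ℂ _ (Θ.symmetrizer * Θ.symmetrizer) := by
        rw [star_symmetrizer, mul_assoc, unitCoeff_mul_comm]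
        simp only [symmetrizer, mul_assoc]
    _ = Θ.symConst := by
        rw [symmetrizer_mul_self, map_smul, unitCoeff_symmetrizer, smul_eq_mul, mul_one]

/-- The Hermitian Young operators as elements of the group algebra, defined by the recursion for
`P` with the idempotent `youngIdempotent` in place of `young`. -/
def hermitianIdempotent : {n : ℕ} → StandardTableau n → MonoidAlgebra ℂ (Equiv.Perm (Fin n))
  | 0, _ => 1
  | n + 1, Θ => extendAlg n Θ.removeLast.hermitianIdempotent * Θ.youngIdempotent *
      extendAlg n Θ.removeLast.hermitianIdempotent

/-- The Hermitian idempotent of the tableau with the last box removed, embedded into the group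
algebra of `S_{n+1}`. -/
def parentIdempotent (Θ : StandardTableau (n + 1)) : MonoidAlgebra ℂ (Equiv.Perm (Fin (n + 1))) :=
  extendAlg n Θ.removeLast.hermitianIdempotent

theorem hermitianIdempotent_succ (Θ : StandardTableau (n + 1)) :
    Θ.hermitianIdempotent = Θ.parentIdempotent * Θ.youngIdempotent * Θ.parentIdempotent :=
  rfl

theorem colAntisymmetrizer_mul_hermitianIdempotent_mul_rowSymmetrizer (Θ : StandardTableau n) :
    Θ.colAntisymmetrizer * Θ.hermitianIdempotent * Θ.rowSymmetrizer =
      Θ.colAntisymmetrizer * Θ.rowSymmetrizer := by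
  induction n with
  | zero => rw [hermitianIdempotent, mul_one]
  | succ n ih =>
    calc Θ.colAntisymmetrizer * Θ.hermitianIdempotent * Θ.rowSymmetrizer
        = Θ.symConst⁻¹ • ((Θ.colAntisymmetrizer * Θ.parentIdempotent * Θ.rowSymmetrizer) *
          (Θ.colAntisymmetrizer * Θ.parentIdempotent * Θ.rowSymmetrizer)) := by
          simp only [hermitianIdempotent_succ, youngIdempotent, symmetrizer, mul_assoc,
            smul_mul_assoc, mul_smul_comm]
      _ = Θ.symConst⁻¹ • (star Θ.symmetrizer * star Θ.symmetrizer) := by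
          rw [parentIdempotent, colAntisymmetrizer_mul_extendAlg_mul_rowSymmetrizer_eq (ih _),
            ← star_symmetrizer]
      _ = Θ.colAntisymmetrizer * Θ.rowSymmetrizer := by
          rw [star_symmetrizer_mul_self, star_symConst, inv_smul_smul₀ Θ.symConst_ne_zero,
            star_symmetrizer]

theorem youngIdempotent_mul_mul_youngIdempotent {Θ : StandardTableau n}
    {x : MonoidAlgebra ℂ (Equiv.Perm (Fin n))}
    (h : Θ.colAntisymmetrizer * x * Θ.rowSymmetrizer =
      Θ.colAntisymmetrizer * Θ.rowSymmetrizer) :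
    Θ.youngIdempotent * x * Θ.youngIdempotent = Θ.youngIdempotent := by
  have hsym : Θ.symmetrizer * x * Θ.symmetrizer = Θ.symmetrizer * Θ.symmetrizer :=
    calc Θ.symmetrizer * x * Θ.symmetrizer = Θ.rowSymmetrizer *
          (Θ.colAntisymmetrizer * x * Θ.rowSymmetrizer) * Θ.colAntisymmetrizer := by
          simp only [symmetrizer, mul_assoc]
      _ = Θ.symmetrizer * Θ.symmetrizer := by
          rw [h]
          simp only [symmetrizer, mul_assoc]
  conv_rhs => rw [← Θ.isIdempotentElem_youngIdempotent.eq]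
  simp only [youngIdempotent, smul_mul_assoc, mul_smul_comm, hsym]

theorem youngIdempotent_mul_parentIdempotent_mul (Θ : StandardTableau (n + 1)) :
    Θ.youngIdempotent * Θ.parentIdempotent * Θ.youngIdempotent = Θ.youngIdempotent :=
  youngIdempotent_mul_mul_youngIdempotent <|
    colAntisymmetrizer_mul_extendAlg_mul_rowSymmetrizer_eq
      Θ.removeLast.colAntisymmetrizer_mul_hermitianIdempotent_mul_rowSymmetrizer

theorem youngIdempotent_mul_hermitianIdempotent_mul (Θ : StandardTableau n) :
    Θ.youngIdempotent * Θ.hermitianIdempotent * Θ.youngIdempotent = Θ.youngIdempotent :=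
  youngIdempotent_mul_mul_youngIdempotent
    Θ.colAntisymmetrizer_mul_hermitianIdempotent_mul_rowSymmetrizer

theorem youngIdempotent_mul_mul_youngIdempotent_eq_zero {Θ Φ : StandardTableau n}
    (h : Θ.shape ≠ Φ.shape) (x : MonoidAlgebra ℂ (Equiv.Perm (Fin n))) :
    Θ.youngIdempotent * x * Φ.youngIdempotent = 0 := by
  rw [youngIdempotent, youngIdempotent, smul_mul_assoc, mul_smul_comm, smul_mul_assoc,
    symmetrizer_mul_mul_symmetrizer_eq_zero h, smul_zero, smul_zero]

theorem orthogonalIdempotents_hermitianIdempotent (n : ℕ) :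
    OrthogonalIdempotents (hermitianIdempotent (n := n)) := by
  induction n with
  | zero => exact OrthogonalIdempotents.unique.2 .one
  | succ n ih =>
    have hq (Θ Φ : StandardTableau (n + 1)) : Θ.parentIdempotent * Φ.parentIdempotent =
        if Θ.removeLast = Φ.removeLast then Θ.parentIdempotent else 0 :=
      (ih.map (extendAlg n).toRingHom).mul_eq _ _
    refine OrthogonalIdempotents.iff_mul_eq.2 fun Θ Φ => ?_
    have hmul : Θ.hermitianIdempotent * Φ.hermitianIdempotent = Θ.parentIdempotent *
        (Θ.youngIdempotent * (Θ.parentIdempotent * Φ.parentIdempotent) * Φ.youngIdempotent) *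
          Φ.parentIdempotent := by
      simp only [hermitianIdempotent_succ, mul_assoc]
    rw [hmul, hq]
    rcases eq_or_ne Θ Φ with rfl | hne
    · rw [if_pos rfl, if_pos rfl, youngIdempotent_mul_parentIdempotent_mul,
        hermitianIdempotent_succ]
    rw [if_neg hne]
    split_ifs with hparent
    · have hs : Θ.shape ≠ Φ.shape := fun hs =>
        hne (eq_of_removeLast_eq_of_shape_eq hparent hs)
      rw [youngIdempotent_mul_mul_youngIdempotent_eq_zero hs, mul_zero, zero_mul]
    · simp

theorem isIdempotentElem_hermitianIdempotent (Θ : StandardTableau n) :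
    IsIdempotentElem Θ.hermitianIdempotent :=
  (orthogonalIdempotents_hermitianIdempotent n).idem Θ

theorem youngIdempotent_eq_one (hn : n ≤ 1) (Θ : StandardTableau n) : Θ.youngIdempotent = 1 := by
  have : Subsingleton (Fin n) := Fin.subsingleton_iff_le_one.2 hn
  exact eq_one_of_isIdempotentElem_of_subsingleton Θ.isIdempotentElem_youngIdempotent
    Θ.youngIdempotent_ne_zero

theorem hermitianIdempotent_mul_youngIdempotent_mul (Θ : StandardTableau n) :
    Θ.hermitianIdempotent * Θ.youngIdempotent * Θ.hermitianIdempotent =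
      Θ.hermitianIdempotent := by
  cases n with
  | zero =>
    rw [hermitianIdempotent, one_mul, mul_one, Θ.youngIdempotent_eq_one zero_le_one]
  | succ n =>
    calc _ = Θ.parentIdempotent * (Θ.youngIdempotent * (Θ.parentIdempotent * Θ.youngIdempotent *
          Θ.parentIdempotent) * Θ.youngIdempotent) * Θ.parentIdempotent := by
          simp only [hermitianIdempotent_succ, mul_assoc]
      _ = Θ.hermitianIdempotent := by
          rw [← hermitianIdempotent_succ, youngIdempotent_mul_hermitianIdempotent_mul,
            hermitianIdempotent_succ]

theorem unitCoeff_hermitianIdempotent (Θ : StandardTableau n) :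
    unitCoeff ℂ _ Θ.hermitianIdempotent = Θ.symConst⁻¹ := by
  rw [apply_eq_apply_of_mul_mul_eq unitCoeff_mul_comm Θ.isIdempotentElem_hermitianIdempotent
    Θ.isIdempotentElem_youngIdempotent Θ.hermitianIdempotent_mul_youngIdempotent_mul
    Θ.youngIdempotent_mul_hermitianIdempotent_mul, unitCoeff_youngIdempotent]

theorem hermitianIdempotent_ne_zero (Θ : StandardTableau n) : Θ.hermitianIdempotent ≠ 0 := by
  intro h
  have hy := Θ.youngIdempotent_mul_hermitianIdempotent_mul
  rw [h, mul_zero, zero_mul] at hy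
  exact Θ.youngIdempotent_ne_zero hy.symm

theorem hermitianIdempotent_eq_one (hn : n ≤ 1) (Θ : StandardTableau n) :
    Θ.hermitianIdempotent = 1 := by
  have : Subsingleton (Fin n) := Fin.subsingleton_iff_le_one.2 hn
  exact eq_one_of_isIdempotentElem_of_subsingleton Θ.isIdempotentElem_hermitianIdempotent
    Θ.hermitianIdempotent_ne_zero

theorem exists_hermitianIdempotent_mul_mul (Θ : StandardTableau n)
    (x : MonoidAlgebra ℂ (Equiv.Perm (Fin n))) :
    ∃ c : ℂ, Θ.hermitianIdempotent * x * Θ.hermitianIdempotent = c • Θ.hermitianIdempotent := by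
  set e := Θ.hermitianIdempotent
  set y := Θ.youngIdempotent with hy
  have heye : e * y * e = e := Θ.hermitianIdempotent_mul_youngIdempotent_mul
  obtain ⟨c, hc⟩ := Θ.exists_youngIdempotent_mul_mul_youngIdempotent (e * x * e)
  refine ⟨c, ?_⟩
  calc e * x * e = e * y * e * x * (e * y * e) := by rw [heye]
    _ = e * (y * (e * x * e) * y) * e := by simp only [mul_assoc]
    _ = c • e := by rw [hc, ← hy, mul_smul_comm, smul_mul_assoc, heye]

theorem exists_perm_of_shape_eq {Θ Φ : StandardTableau n} (h : Θ.shape = Φ.shape) :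
    ∃ g : Equiv.Perm (Fin n), ∀ k, Φ.pos (g k) = Θ.pos k := by
  have hex (k : Fin n) : ∃ l, Φ.pos l = Θ.pos k := by
    rw [← Φ.mem_shape_iff, ← h, Θ.mem_shape_iff]
    exact ⟨k, rfl⟩
  choose u hu using hex
  have hinj : Function.Injective u := fun k l hkl => Θ.pos_injective (by rw [← hu, ← hu, hkl])
  exact ⟨Equiv.ofBijective u (Finite.injective_iff_bijective.1 hinj), hu⟩

theorem exists_single_mul_symmetrizer {Θ Φ : StandardTableau n} (h : Θ.shape = Φ.shape) :
    ∃ g : Equiv.Perm (Fin n), single g 1 * Θ.symmetrizer = Φ.symmetrizer * single g 1 := by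
  obtain ⟨g, hg⟩ := exists_perm_of_shape_eq h
  have hrow : single g 1 * Θ.rowSymmetrizer = Φ.rowSymmetrizer * single g 1 := by
    rw [rowSymmetrizer_eq_charSum, rowSymmetrizer_eq_charSum]
    exact single_mul_charSum_eq_charSum_mul_single
      (conj_mem_fiberPerms_iff fun k => congrArg Prod.fst (hg k))
  have hcol : single g 1 * Θ.colAntisymmetrizer = Φ.colAntisymmetrizer * single g 1 := by
    rw [colAntisymmetrizer_eq_charSum, colAntisymmetrizer_eq_charSum]
    exact single_mul_charSum_eq_charSum_mul_single
      (conj_mem_fiberPerms_iff fun k => congrArg Prod.snd (hg k))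
  exact ⟨g, by rw [symmetrizer, symmetrizer, ← mul_assoc, hrow, mul_assoc, hcol, mul_assoc]⟩

/-- The dimension of the right ideal generated by the Young symmetrizer, i.e. of the irreducible
representation of `S_n` attached to the shape. -/
def idealDim (Θ : StandardTableau n) : ℕ :=
  Module.finrank ℂ (LinearMap.range (LinearMap.mulLeft ℂ Θ.youngIdempotent))

theorem idealDim_eq (Θ : StandardTableau n) :
    (Θ.idealDim : ℂ) = n.factorial * Θ.symConst⁻¹ := by
  rw [idealDim, ← card_mul_unitCoeff Θ.isIdempotentElem_youngIdempotent,
    unitCoeff_youngIdempotent, Nat.card_perm, Nat.card_fin]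

theorem sum_idealDim_le (n : ℕ) : ∑ Θ : StandardTableau n, Θ.idealDim ≤ n.factorial := by
  have h := card_mul_unitCoeff
    ((orthogonalIdempotents_hermitianIdempotent n).isIdempotentElem_sum (s := Finset.univ)).one_sub
  simp only [map_sub, map_sum, unitCoeff_one, unitCoeff_hermitianIdempotent, mul_sub, mul_one,
    Nat.card_perm, Nat.card_fin, Finset.mul_sum, ← idealDim_eq, sub_eq_iff_eq_add] at h
  norm_cast at h
  omega

theorem card_ofShape_le (Φ : StandardTableau n) : (ofShape n Φ.shape).card ≤ Φ.idealDim := by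
  have := finite_groupAlgebra (K := ℂ) (G := Equiv.Perm (Fin n))
  have hconj (Θ : ofShape n Φ.shape) :
      ∃ g, single g 1 * Θ.1.symmetrizer = Φ.symmetrizer * single g 1 :=
    exists_single_mul_symmetrizer (mem_ofShape.1 Θ.2)
  choose g hg using hconj
  let v (Θ : ofShape n Φ.shape) := Φ.youngIdempotent * single (g Θ) 1 * Θ.1.hermitianIdempotent
  have hv (Θ) : v Θ ≠ 0 := by
    have hunit : IsUnit (single (g Θ) (1 : ℂ)) := (Group.isUnit (g Θ)).map (MonoidAlgebra.of ℂ _)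
    intro h
    simp only [v, youngIdempotent, smul_mul_assoc, ← hg, mul_assoc, smul_eq_zero,
      hunit.mul_right_eq_zero] at h
    have hy := Θ.1.youngIdempotent_mul_hermitianIdempotent_mul
    rw [youngIdempotent, smul_mul_assoc, h.resolve_left (inv_ne_zero Φ.symConst_ne_zero),
      smul_zero, zero_mul] at hy
    exact Θ.1.youngIdempotent_ne_zero hy.symm
  have hlin : LinearIndependent ℂ v := linearIndependent_of_mul_eq_self
    ((orthogonalIdempotents_hermitianIdempotent n).embedding (.subtype _))
    (fun Θ => by
      rw [mul_assoc]
      exact congrArg _ Θ.1.isIdempotentElem_hermitianIdempotent.eq) hv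
  have hspan : Submodule.span ℂ (Set.range v) ≤
      LinearMap.range (LinearMap.mulLeft ℂ Φ.youngIdempotent) := by
    rw [Submodule.span_le]
    rintro _ ⟨Θ, rfl⟩
    exact ⟨single (g Θ) 1 * Θ.1.hermitianIdempotent, (mul_assoc _ _ _).symm⟩
  rw [idealDim]
  simpa [finrank_span_eq_card hlin] using Submodule.finrank_mono hspan

-- The number `f` of tableaux of a given shape is at most the dimension `d` of the ideal, while
-- `∑ f = n!` by the hook length formula and `∑ d ≤ n!`, both sums being over all tableaux.
theorem symConst_eq_hookProduct (Θ : StandardTableau n) : Θ.symConst = Θ.hookProduct := by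
  have hf (Φ : StandardTableau n) :
      ((ofShape n Φ.shape).card : ℚ) = n.factorial * (Φ.hookProduct : ℚ)⁻¹ :=
    card_ofShape Φ.card_shape
  have hsum : ∑ Φ : StandardTableau n, (ofShape n Φ.shape).card = n.factorial := by
    have h : (∑ Φ : StandardTableau n, (ofShape n Φ.shape).card : ℚ) = n.factorial := by
      rw [Finset.sum_congr rfl fun Φ _ => hf Φ, ← Finset.mul_sum, sum_inv_hookProduct, mul_one]
    exact_mod_cast h
  have hle (Φ : StandardTableau n) (_ : Φ ∈ Finset.univ) := Φ.card_ofShape_le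
  have hcard : (ofShape n Θ.shape).card = Θ.idealDim :=
    (Finset.sum_eq_sum_iff_of_le hle).1 ((Finset.sum_le_sum hle).antisymm
      ((sum_idealDim_le n).trans hsum.ge)) Θ (Finset.mem_univ Θ)
  have hfact : (n.factorial : ℂ) ≠ 0 := Nat.cast_ne_zero.2 n.factorial_ne_zero
  have hcast : ((ofShape n Θ.shape).card : ℂ) = n.factorial * (Θ.hookProduct : ℂ)⁻¹ := by
    simpa only [Rat.cast_mul, Rat.cast_inv, Rat.cast_natCast] using
      congrArg (Rat.cast : ℚ → ℂ) (hf Θ)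
  rw [hcard, idealDim_eq] at hcast
  exact inv_injective (mul_left_cancel₀ hfact hcast)

theorem young_eq_youngIdempotent (Θ : StandardTableau n) : Θ.young = Θ.youngIdempotent := by
  rw [young, youngIdempotent, symConst_eq_hookProduct, symmetrizer]

theorem sum_hermitianIdempotent (n : ℕ) :
    ∑ Θ : StandardTableau n, Θ.hermitianIdempotent = 1 := by
  have hcoeff : unitCoeff ℂ _ (1 - ∑ Θ : StandardTableau n, Θ.hermitianIdempotent) = 0 := by
    simp only [map_sub, map_sum, unitCoeff_one, unitCoeff_hermitianIdempotent,
      symConst_eq_hookProduct]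
    rw [sub_eq_zero]
    simpa only [Rat.cast_sum, Rat.cast_inv, Rat.cast_natCast, Rat.cast_one] using
      congrArg (Rat.cast : ℚ → ℂ) (sum_inv_hookProduct n).symm
  exact (sub_eq_zero.1 (eq_zero_of_unitCoeff_eq_zero
    ((orthogonalIdempotents_hermitianIdempotent n).isIdempotentElem_sum
      (s := Finset.univ)).one_sub hcoeff)).symm

theorem star_youngIdempotent_mul_mul_youngIdempotent_eq_zero {Θ Φ : StandardTableau n}
    (h : Θ.shape ≠ Φ.shape) (x : MonoidAlgebra ℂ (Equiv.Perm (Fin n))) :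
    star Θ.youngIdempotent * x * Φ.youngIdempotent = 0 := by
  have hy : star Θ.youngIdempotent =
      Θ.symConst⁻¹ • (Θ.colAntisymmetrizer * Θ.youngIdempotent * Θ.rowSymmetrizer) :=
    calc star Θ.youngIdempotent = star Θ.youngIdempotent * star Θ.youngIdempotent :=
          Θ.isIdempotentElem_youngIdempotent.star.eq.symm
      _ = _ := by
          rw [youngIdempotent, star_smul, star_inv₀, star_symConst, star_symmetrizer, symmetrizer]
          simp only [mul_assoc, smul_mul_assoc, mul_smul_comm]
  calc star Θ.youngIdempotent * x * Φ.youngIdempotent = Θ.symConst⁻¹ • (Θ.colAntisymmetrizer *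
        (Θ.youngIdempotent * (Θ.rowSymmetrizer * x) * Φ.youngIdempotent)) := by
        rw [hy]
        simp only [mul_assoc, smul_mul_assoc]
    _ = 0 := by rw [youngIdempotent_mul_mul_youngIdempotent_eq_zero h, mul_zero, smul_zero]

theorem isSelfAdjoint_hermitianIdempotent (Θ : StandardTableau n) :
    IsSelfAdjoint Θ.hermitianIdempotent := by
  induction n with
  | zero => exact .one _
  | succ n ih =>
    have hstar (Φ : StandardTableau (n + 1)) : star Φ.parentIdempotent = Φ.parentIdempotent := by
      rw [parentIdempotent, star_extendAlg, (ih _).star_eq]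
    refine isSelfAdjoint_of_sum_eq_one (sum_hermitianIdempotent (n + 1)) (fun Φ Ψ hne => ?_) Θ
    have hmul : star Φ.hermitianIdempotent * Ψ.hermitianIdempotent = Φ.parentIdempotent *
        (star Φ.youngIdempotent * (Φ.parentIdempotent * Ψ.parentIdempotent) *
          Ψ.youngIdempotent) * Ψ.parentIdempotent := by
      simp only [hermitianIdempotent_succ, star_mul, hstar, mul_assoc]
    rw [hmul]
    by_cases hparent : Φ.removeLast = Ψ.removeLast
    · have hs : Φ.shape ≠ Ψ.shape := fun hs =>
        hne (eq_of_removeLast_eq_of_shape_eq hparent hs)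
      rw [star_youngIdempotent_mul_mul_youngIdempotent_eq_zero hs, mul_zero, zero_mul]
    · have horth : Φ.parentIdempotent * Ψ.parentIdempotent = 0 := by
        rw [parentIdempotent, parentIdempotent, ← map_mul,
          (orthogonalIdempotents_hermitianIdempotent n).ortho hparent, map_zero]
      rw [horth, mul_zero, zero_mul, mul_zero, zero_mul]

end StandardTableau

/-! ### The operators on the tensor power -/

section GroupAlgebraAction

variable {K G E : Type*} [Field K] [Group G] [AddCommGroup E] [Module K E]
  {ρ : Representation K G E}

theorem commute_asAlgebraHom {T : Module.End K E} (hT : ∀ g, Commute (ρ g) T)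
    (x : MonoidAlgebra K G) : Commute (ρ.asAlgebraHom x) T := by
  induction x using MonoidAlgebra.induction_linear with
  | zero => simp
  | add x y hx hy => simpa only [map_add] using hx.add_left hy
  | single g c => simpa only [Representation.asAlgebraHom_single] using (hT g).smul_left c

theorem asAlgebraHom_charSum_apply_eq_zero [CharZero K] [Finite G] {χ : G →* ℤˣ} {H : Subgroup G}
    {g : G} (hg : g ∈ H) (hχ : χ g = -1) {v : E} (hv : ρ g v = v) :
    ρ.asAlgebraHom (charSum K χ H) v = 0 := by
  have : IsAddTorsionFree E := .of_isTorsionFree K E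
  refine self_eq_neg.1 ?_
  calc ρ.asAlgebraHom (charSum K χ H) v
      = ρ.asAlgebraHom (charSum K χ H * single g 1) v := by
        rw [map_mul, Module.End.mul_apply, Representation.asAlgebraHom_single_one, hv]
    _ = -ρ.asAlgebraHom (charSum K χ H) v := by simp [charSum_mul_single hg, hχ]

end GroupAlgebraAction

section PermRep

variable {N n : ℕ}

theorem permRep_tprod (σ : Equiv.Perm (Fin n)) (v : Fin n → V N) :
    permRep N n σ (PiTensorProduct.tprod ℂ v) = PiTensorProduct.tprod ℂ fun i => v (σ⁻¹ i) :=
  PiTensorProduct.reindex_tprod σ v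

theorem stdBasis_apply (a : Fin n → Fin N) :
    stdBasis N n a =
      PiTensorProduct.tprod ℂ fun i => EuclideanSpace.basisFun (Fin N) ℂ (a i) := by
  simp [stdBasis]

theorem permRep_stdBasis (σ : Equiv.Perm (Fin n)) (a : Fin n → Fin N) :
    permRep N n σ (stdBasis N n a) = stdBasis N n (a ∘ ⇑σ⁻¹) := by
  rw [stdBasis_apply, permRep_tprod, stdBasis_apply]
  rfl

theorem stdBasis_repr_permRep (σ : Equiv.Perm (Fin n)) (x : VPow N n) (a : Fin n → Fin N) :
    (stdBasis N n).repr (permRep N n σ x) a = (stdBasis N n).repr x (a ∘ σ) := by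
  classical
  have h : Finsupp.lapply a ∘ₗ (stdBasis N n).repr.toLinearMap ∘ₗ permRep N n σ =
      Finsupp.lapply (a ∘ σ) ∘ₗ (stdBasis N n).repr.toLinearMap := by
    refine (stdBasis N n).ext fun b => ?_
    simp only [LinearMap.comp_apply, LinearEquiv.coe_coe, permRep_stdBasis, Module.Basis.repr_self,
      Finsupp.lapply_apply, Finsupp.single_apply]
    exact if_congr (Equiv.comp_symm_eq σ a b) rfl rfl
  exact LinearMap.congr_fun h x

variable (N n) in
/-- The action of the group algebra of `S_n` on `V^{⊗ n}`. -/
abbrev algRep : MonoidAlgebra ℂ (Equiv.Perm (Fin n)) →ₐ[ℂ] Module.End ℂ (VPow N n) :=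
  (permRep N n).asAlgebraHom

theorem tensorOne_tprod (A : Module.End ℂ (VPow N n)) (v : Fin (n + 1) → V N) :
    tensorOne A (PiTensorProduct.tprod ℂ v) = TensorPower.mulEquiv
      (A (PiTensorProduct.tprod ℂ (Fin.init v)) ⊗ₜ
        PiTensorProduct.tprod ℂ fun _ : Fin 1 => v (Fin.last n)) := by
  have hv : PiTensorProduct.tprod ℂ v = TensorPower.mulEquiv
      (PiTensorProduct.tprod ℂ (Fin.init v) ⊗ₜ
        PiTensorProduct.tprod ℂ fun _ : Fin 1 => v (Fin.last n)) := by
    refine Eq.trans ?_ (TensorPower.tprod_mul_tprod ℂ (Fin.init v) _).symm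
    rw [Fin.append_right_eq_snoc, Fin.snoc_init_self]
  rw [hv, tensorOne, LinearEquiv.conj_apply_apply, LinearEquiv.symm_apply_apply,
    TensorProduct.map_tmul, LinearMap.id_apply]

theorem tensorOne_permRep (σ : Equiv.Perm (Fin n)) :
    tensorOne (permRep N n σ) = permRep N (n + 1) (extendPerm n σ) := by
  refine PiTensorProduct.ext (MultilinearMap.ext fun v => ?_)
  change tensorOne (permRep N n σ) (PiTensorProduct.tprod ℂ v) =
    permRep N (n + 1) (extendPerm n σ) (PiTensorProduct.tprod ℂ v)
  rw [tensorOne_tprod, permRep_tprod, permRep_tprod, ← map_inv]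
  refine (TensorPower.tprod_mul_tprod ℂ _ _).trans (congrArg _ ?_)
  rw [Fin.append_right_eq_snoc]
  funext i
  induction i using Fin.lastCases with
  | last => rw [Fin.snoc_last, extendPerm_last]
  | cast i => rw [Fin.snoc_castSucc, extendPerm_castSucc, Fin.init]

theorem tensorOne_add (A B : Module.End ℂ (VPow N n)) :
    tensorOne (A + B) = tensorOne A + tensorOne B := by
  simp [tensorOne, TensorProduct.map_add_left]

theorem tensorOne_smul (c : ℂ) (A : Module.End ℂ (VPow N n)) :
    tensorOne (c • A) = c • tensorOne A := by
  simp [tensorOne, TensorProduct.map_smul_left]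

theorem tensorOne_algRep (x : MonoidAlgebra ℂ (Equiv.Perm (Fin n))) :
    tensorOne (algRep N n x) = algRep N (n + 1) (extendAlg n x) := by
  induction x using MonoidAlgebra.induction_linear with
  | zero => simpa using tensorOne_smul (0 : ℂ) (0 : Module.End ℂ (VPow N n))
  | add x y hx hy => rw [map_add, tensorOne_add, hx, hy, map_add, map_add]
  | single σ c =>
    rw [extendAlg_single, Representation.asAlgebraHom_single, tensorOne_smul, tensorOne_permRep,
      Representation.asAlgebraHom_single]

theorem tensorInner_permRep (σ : Equiv.Perm (Fin n)) (x y : VPow N n) :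
    tensorInner (permRep N n σ x) y = tensorInner x (permRep N n σ⁻¹ y) := by
  simp only [tensorInner, stdBasis_repr_permRep]
  refine Fintype.sum_equiv (Equiv.arrowCongr σ.symm (Equiv.refl (Fin N))) _ _ fun a => ?_
  congr 2
  ext i
  simp

theorem tensorInner_add_left (x x' y : VPow N n) :
    tensorInner (x + x') y = tensorInner x y + tensorInner x' y := by
  simp [tensorInner, add_mul, Finset.sum_add_distrib]

theorem tensorInner_add_right (x y y' : VPow N n) :
    tensorInner x (y + y') = tensorInner x y + tensorInner x y' := by
  simp [tensorInner, mul_add, Finset.sum_add_distrib]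

theorem tensorInner_smul_left (c : ℂ) (x y : VPow N n) :
    tensorInner (c • x) y = star c * tensorInner x y := by
  simp [tensorInner, Finset.mul_sum, mul_assoc]

theorem tensorInner_smul_right (c : ℂ) (x y : VPow N n) :
    tensorInner x (c • y) = c * tensorInner x y := by
  simp [tensorInner, Finset.mul_sum, mul_left_comm]

theorem tensorInner_algRep (z : MonoidAlgebra ℂ (Equiv.Perm (Fin n))) (x y : VPow N n) :
    tensorInner (algRep N n z x) y = tensorInner x (algRep N n (star z) y) := by
  induction z using MonoidAlgebra.induction_linear with
  | zero => simp [tensorInner]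
  | add z w hz hw =>
    rw [star_add, map_add, map_add, LinearMap.add_apply, LinearMap.add_apply, tensorInner_add_left,
      tensorInner_add_right, hz, hw]
  | single σ c =>
    rw [star_single, Representation.asAlgebraHom_single, Representation.asAlgebraHom_single,
      LinearMap.smul_apply, LinearMap.smul_apply, tensorInner_smul_left, tensorInner_smul_right,
      tensorInner_permRep]

end PermRep

section Projectors

variable (N : ℕ) {n : ℕ} (Θ : StandardTableau n)

theorem Y_eq_algRep : Y N Θ = algRep N n Θ.youngIdempotent := by
  rw [Y, Θ.young_eq_youngIdempotent]

theorem P_eq_algRep : P N Θ = algRep N n Θ.hermitianIdempotent := by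
  induction n with
  | zero => rw [P, Y_eq_algRep, Θ.youngIdempotent_eq_one zero_le_one,
      Θ.hermitianIdempotent_eq_one zero_le_one]
  | succ n ih =>
    have hparent : algRep N (n + 1) Θ.parentIdempotent = tensorOne (P N Θ.removeLast) := by
      rw [StandardTableau.parentIdempotent, ← tensorOne_algRep, ih]
    have hone (hn : n ≤ 1) : tensorOne (P N Θ.removeLast) = 1 := by
      rw [ih, tensorOne_algRep, StandardTableau.hermitianIdempotent_eq_one hn, map_one, map_one]
    rw [StandardTableau.hermitianIdempotent_succ, map_mul, map_mul, ← Y_eq_algRep, hparent]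
    rcases n with _ | _ | n
    · rw [hone zero_le_one, one_mul, mul_one, P]
    · rw [hone le_rfl, one_mul, mul_one, P]
    · rw [P]

theorem orthogonalIdempotents_P (n : ℕ) : OrthogonalIdempotents (P N (n := n)) := by
  rw [funext (P_eq_algRep N)]
  exact (StandardTableau.orthogonalIdempotents_hermitianIdempotent n).map (algRep N n).toRingHom

theorem sum_P (n : ℕ) : ∑ Θ : StandardTableau n, P N Θ = 1 := by
  simp only [P_eq_algRep, ← map_sum, StandardTableau.sum_hermitianIdempotent, map_one]

theorem trace_P : LinearMap.trace ℂ (VPow N n) (P N Θ) = LinearMap.trace ℂ (VPow N n) (Y N Θ) := by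
  rw [P_eq_algRep, Y_eq_algRep]
  exact apply_eq_apply_of_mul_mul_eq
    (τ := fun x => LinearMap.trace ℂ (VPow N n) (algRep N n x))
    (fun x y => by simp only [map_mul (algRep N n), LinearMap.trace_mul_comm])
    Θ.isIdempotentElem_hermitianIdempotent Θ.isIdempotentElem_youngIdempotent
    Θ.hermitianIdempotent_mul_youngIdempotent_mul Θ.youngIdempotent_mul_hermitianIdempotent_mul

theorem isHermitianOp_P : IsHermitianOp (P N Θ) := by
  intro x y
  rw [P_eq_algRep, tensorInner_algRep, Θ.isSelfAdjoint_hermitianIdempotent.star_eq]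

variable {N} {Θ}

theorem isOrthogonalProjectorOnto_range {A : Module.End ℂ (VPow N n)} (hA : IsHermitianOp A)
    (hidem : IsIdempotentElem A) : IsOrthogonalProjectorOnto A (LinearMap.range A) := by
  refine fun x => ⟨⟨x, rfl⟩, ?_⟩
  rintro _ ⟨y, rfl⟩
  rw [hA, map_sub, ← Module.End.mul_apply, hidem.eq, sub_self]
  simp [tensorInner]

theorem algRep_colAntisymmetrizer_eq_zero (h : N < Θ.numRows) :
    algRep N n Θ.colAntisymmetrizer = 0 := by
  refine (stdBasis N n).ext fun a => ?_
  have hmem (k : Fin Θ.numRows) : ∃ i, Θ.pos i = ((k : ℕ), 0) := by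
    rw [← Θ.mem_shape_iff, YoungDiagram.mem_iff_lt_colLen]
    exact k.2
  choose i hi using hmem
  obtain ⟨k, l, hkl, ha⟩ := Fintype.exists_ne_map_eq_of_card_lt (fun k => a (i k)) (by simpa)
  have hne : i k ≠ i l := fun h => hkl (Fin.ext (by simpa [hi] using congrArg Θ.pos h))
  have hswap : Equiv.swap (i k) (i l) ∈ Θ.colGroup := swap_mem_fiberPerms (by rw [hi, hi])
  have hfix : permRep N n (Equiv.swap (i k) (i l)) (stdBasis N n a) = stdBasis N n a := by
    rw [permRep_stdBasis]
    exact congrArg _ (funext (swap_mem_fiberPerms ha))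
  rw [Θ.colAntisymmetrizer_eq_charSum, LinearMap.zero_apply]
  exact asAlgebraHom_charSum_apply_eq_zero hswap (Equiv.Perm.sign_swap hne) hfix

theorem P_eq_zero (h : N < Θ.numRows) : P N Θ = 0 := by
  rw [P_eq_algRep, ← Θ.hermitianIdempotent_mul_youngIdempotent_mul,
    StandardTableau.youngIdempotent, StandardTableau.symmetrizer, map_mul, map_mul, map_smul,
    map_mul, algRep_colAntisymmetrizer_eq_zero h, mul_zero, smul_zero, mul_zero, zero_mul]

theorem fst_pos_lt_numRows (i : Fin n) : (Θ.pos i).1 < Θ.numRows := by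
  have hi : Θ.pos i ∈ Θ.shape := (Θ.mem_shape_iff _).2 ⟨i, rfl⟩
  exact YoungDiagram.mem_iff_lt_colLen.1 (Θ.shape.up_left_mem le_rfl (Nat.zero_le _) hi)

theorem stdBasis_repr_algRep_rowSymmetrizer {b : Fin n → Fin N}
    (hb : ∀ σ ∈ Θ.rowPerms, b ∘ σ = b) (x : VPow N n) :
    (stdBasis N n).repr (algRep N n Θ.rowSymmetrizer x) b =
      Θ.rowPerms.card * (stdBasis N n).repr x b := by
  simp only [StandardTableau.rowSymmetrizer, map_sum, Representation.asAlgebraHom_single_one,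
    LinearMap.sum_apply, Finsupp.finsetSum_apply, stdBasis_repr_permRep]
  rw [Finset.sum_congr rfl fun σ hσ => by rw [hb σ hσ], Finset.sum_const, nsmul_eq_mul]

theorem stdBasis_repr_algRep_colAntisymmetrizer {b : Fin n → Fin N}
    (hb : ∀ σ : Equiv.Perm (Fin n), b ∘ σ = b → σ ∈ Θ.rowGroup) :
    (stdBasis N n).repr (algRep N n Θ.colAntisymmetrizer (stdBasis N n b)) b = 1 := by
  have hone : 1 ∈ Θ.colPerms := by simp [StandardTableau.colPerms]
  simp only [StandardTableau.colAntisymmetrizer, map_sum, Representation.asAlgebraHom_single,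
    LinearMap.sum_apply, LinearMap.smul_apply, map_smul, Finsupp.finsetSum_apply,
    Finsupp.smul_apply, stdBasis_repr_permRep, Module.Basis.repr_self]
  rw [Finset.sum_eq_single_of_mem 1 hone]
  · simp
  · intro σ hσ hne
    rw [Finsupp.single_eq_of_ne, smul_zero]
    intro h
    refine hne (Subgroup.disjoint_def.1 Θ.disjoint_rowGroup_colGroup (hb σ h) ?_)
    simpa [StandardTableau.colPerms, mem_fiberPerms] using hσ

-- The basis vector whose `i`-th factor is `e_r`, `r` being the row of the entry `i`, is fixed by
-- the horizontal permutations and by no other one.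
theorem P_ne_zero (h : Θ.numRows ≤ N) : P N Θ ≠ 0 := by
  let b (i : Fin n) : Fin N := ⟨(Θ.pos i).1, (fst_pos_lt_numRows i).trans_le h⟩
  have hb (σ : Equiv.Perm (Fin n)) : b ∘ σ = b ↔ σ ∈ Θ.rowGroup := by
    simp [b, funext_iff, Fin.ext_iff, mem_fiberPerms]
  have hmem (σ : Equiv.Perm (Fin n)) : σ ∈ Θ.rowPerms ↔ σ ∈ Θ.rowGroup := by
    simp [StandardTableau.rowPerms, mem_fiberPerms]
  have hcoeff : (stdBasis N n).repr (algRep N n Θ.symmetrizer (stdBasis N n b)) b =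
      Θ.rowPerms.card := by
    rw [StandardTableau.symmetrizer, map_mul, Module.End.mul_apply,
      stdBasis_repr_algRep_rowSymmetrizer fun σ hσ => (hb σ).2 ((hmem σ).1 hσ),
      stdBasis_repr_algRep_colAntisymmetrizer fun σ => (hb σ).1, mul_one]
  intro hP
  have hy : algRep N n Θ.youngIdempotent = 0 := by
    rw [← Θ.youngIdempotent_mul_hermitianIdempotent_mul, map_mul, map_mul, ← P_eq_algRep, hP,
      mul_zero, zero_mul]
  rw [StandardTableau.youngIdempotent, map_smul,
    smul_eq_zero_iff_right (inv_ne_zero Θ.symConst_ne_zero)] at hy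
  rw [hy, LinearMap.zero_apply, map_zero, Finsupp.zero_apply, eq_comm, Nat.cast_eq_zero] at hcoeff
  exact Finset.card_ne_zero_of_mem ((hmem 1).2 (one_mem _)) hcoeff

end Projectors

/-! ### The unitary trick -/

section UnitaryTrick

variable {ι : Type*} [Fintype ι] [DecidableEq ι]

theorem infinite_sphere_complex : (Metric.sphere (0 : ℂ) 1).Infinite := by
  have hrank : 1 < Module.rank ℝ ℂ := by rw [Complex.rank_real_complex]; norm_num
  exact (isPreconnected_sphere hrank 0 1).infinite_of_nontrivial
    ⟨1, by simp, -1, by simp, by norm_num⟩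

theorem diagonal_mem_unitaryGroup {d : ι → ℂ} (hd : ∀ i, ‖d i‖ = 1) :
    Matrix.diagonal d ∈ Matrix.unitaryGroup ι ℂ := by
  rw [Matrix.mem_unitaryGroup_iff', Matrix.star_eq_conjTranspose, Matrix.diagonal_conjTranspose,
    Matrix.diagonal_mul_diagonal, ← Matrix.diagonal_one]
  congr 1
  funext i
  rw [Pi.star_apply, Complex.star_def, Complex.conj_mul', hd, Complex.ofReal_one, one_pow]

theorem mul_diagonal_mem_unitaryGroup {A : Matrix ι ι ℂ} {lam : ι → ℝ} (hlam : ∀ i, 0 < lam i)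
    (hA : A.conjTranspose * A = Matrix.diagonal fun i => (lam i : ℂ)) :
    A * Matrix.diagonal (fun i => ((√(lam i) : ℝ) : ℂ)⁻¹) ∈ Matrix.unitaryGroup ι ℂ := by
  rw [Matrix.mem_unitaryGroup_iff', Matrix.star_eq_conjTranspose, Matrix.conjTranspose_mul,
    ← Matrix.mul_assoc, Matrix.mul_assoc _ _ A, hA, Matrix.diagonal_conjTranspose,
    Matrix.diagonal_mul_diagonal, Matrix.diagonal_mul_diagonal, ← Matrix.diagonal_one]
  congr 1
  funext i
  have hsq : (lam i : ℂ) = (√(lam i) : ℝ) * (√(lam i) : ℝ) := by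
    rw [← Complex.ofReal_mul, Real.mul_self_sqrt (hlam i).le]
  have hne : ((√(lam i) : ℝ) : ℂ) ≠ 0 := Complex.ofReal_ne_zero.2 (Real.sqrt_pos.2 (hlam i)).ne'
  simp only [Pi.star_apply, star_inv₀, Complex.star_def, Complex.conj_ofReal]
  rw [hsq]
  field_simp

open scoped ComplexOrder in
theorem exists_unitary_mul_diagonal_mul_unitary {X : Matrix ι ι ℂ} (hX : IsUnit X) :
    ∃ U ∈ Matrix.unitaryGroup ι ℂ, ∃ d : ι → ℂ, ∃ W ∈ Matrix.unitaryGroup ι ℂ,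
      X = U * Matrix.diagonal d * W := by
  have hpos : (X.conjTranspose * X).PosDef :=
    .conjTranspose_mul_self X (Matrix.mulVec_injective_of_isUnit hX)
  let E : Matrix ι ι ℂ := hpos.1.eigenvectorUnitary.1
  let lam := hpos.1.eigenvalues
  have hlam : ∀ i, 0 < lam i := hpos.eigenvalues_pos
  have hE : star E * E = 1 := Unitary.coe_star_mul_self _
  have hE' : E * star E = 1 := Unitary.coe_mul_star_self _
  have hspec : X.conjTranspose * X = E * Matrix.diagonal (fun i => (lam i : ℂ)) * star E := by
    have h := hpos.1.spectral_theorem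
    rwa [Unitary.conjStarAlgAut_apply] at h
  have hXE : (X * E).conjTranspose * (X * E) = Matrix.diagonal fun i => (lam i : ℂ) :=
    calc (X * E).conjTranspose * (X * E) = star E * (X.conjTranspose * X) * E := by
          rw [Matrix.conjTranspose_mul, Matrix.star_eq_conjTranspose]
          simp only [Matrix.mul_assoc]
      _ = (star E * E) * Matrix.diagonal (fun i => (lam i : ℂ)) * (star E * E) := by
          rw [hspec]
          simp only [Matrix.mul_assoc]
      _ = _ := by rw [hE, Matrix.one_mul, Matrix.mul_one]
  refine ⟨_, mul_diagonal_mem_unitaryGroup hlam hXE, fun i => (√(lam i) : ℝ), star E,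
    Unitary.star_mem hpos.1.eigenvectorUnitary.2, ?_⟩
  have hone : (fun i => ((√(lam i) : ℝ) : ℂ)⁻¹ * (√(lam i) : ℝ)) = 1 := funext fun i =>
    inv_mul_cancel₀ (Complex.ofReal_ne_zero.2 (Real.sqrt_pos.2 (hlam i)).ne')
  rw [Matrix.mul_assoc (X * E), Matrix.diagonal_mul_diagonal, hone, Matrix.diagonal_one',
    Matrix.mul_one, Matrix.mul_assoc, hE', Matrix.mul_one]

variable {Q : MvPolynomial (ι × ι) ℂ}

-- The matrices `U D W` with `D` diagonal are polynomial in the entries of `D`, and the torus of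
-- unitary diagonal matrices is Zariski dense in the diagonal ones.
theorem eval_mul_diagonal_mul_eq_zero
    (hQ : ∀ U ∈ Matrix.unitaryGroup ι ℂ, MvPolynomial.eval (fun p => U p.1 p.2) Q = 0)
    {U W : Matrix ι ι ℂ} (hU : U ∈ Matrix.unitaryGroup ι ℂ) (hW : W ∈ Matrix.unitaryGroup ι ℂ)
    (d : ι → ℂ) :
    MvPolynomial.eval (fun p => (U * Matrix.diagonal d * W) p.1 p.2) Q = 0 := by
  let R : MvPolynomial ι ℂ := MvPolynomial.bind₁
    (fun p => ∑ k, MvPolynomial.C (U p.1 k * W k p.2) * MvPolynomial.X k) Q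
  have hR (t : ι → ℂ) : MvPolynomial.eval t R =
      MvPolynomial.eval (fun p => (U * Matrix.diagonal t * W) p.1 p.2) Q := by
    rw [MvPolynomial.eval, MvPolynomial.eval₂Hom_bind₁]
    congr 2
    funext p
    rw [Matrix.mul_apply]
    simp [Matrix.mul_diagonal, mul_right_comm]
  have hzero : R = 0 := by
    refine MvPolynomial.funext_set (fun _ => Metric.sphere 0 1) (fun _ => infinite_sphere_complex)
      fun t ht => ?_
    rw [map_zero, hR]
    refine hQ _ (mul_mem (mul_mem hU (diagonal_mem_unitaryGroup fun i => ?_)) hW)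
    simpa using ht i (Set.mem_univ i)
  rw [← hR, hzero, map_zero]

theorem eq_zero_of_forall_unitary
    (hQ : ∀ U ∈ Matrix.unitaryGroup ι ℂ, MvPolynomial.eval (fun p => U p.1 p.2) Q = 0) : Q = 0 := by
  have hmul : Q * (Matrix.mvPolynomialX ι ι ℂ).det = 0 := by
    refine MvPolynomial.funext fun t => ?_
    let X : Matrix ι ι ℂ := .of fun i j => t (i, j)
    have hdet : MvPolynomial.eval t (Matrix.mvPolynomialX ι ι ℂ).det = X.det := by
      rw [RingHom.map_det]
      exact congrArg Matrix.det (Matrix.mvPolynomialX_mapMatrix_eval X)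
    rw [map_mul, map_zero, hdet]
    by_cases hX : IsUnit X
    · obtain ⟨U, hU, d, W, hW, hUdW⟩ := exists_unitary_mul_diagonal_mul_unitary hX
      have h := eval_mul_diagonal_mul_eq_zero hQ hU hW d
      rw [← hUdW] at h
      exact mul_eq_zero_of_left h _
    · rw [Matrix.isUnit_iff_isUnit_det, isUnit_iff_ne_zero, not_not] at hX
      rw [hX, mul_zero]
  exact (mul_eq_zero.1 hmul).resolve_right (Matrix.det_mvPolynomialX_ne_zero ι ℂ)

theorem exists_eq_smul_specialUnitary {U : Matrix ι ι ℂ} (hU : U ∈ Matrix.unitaryGroup ι ℂ) :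
    ∃ (c : ℂ) (g : Matrix.specialUnitaryGroup ι ℂ), U = c • g.1 := by
  cases isEmpty_or_nonempty ι with
  | inl _ => exact ⟨1, 1, Subsingleton.elim _ _⟩
  | inr _ =>
    obtain ⟨c, hc⟩ := IsAlgClosed.exists_pow_nat_eq U.det (Fintype.card_pos (α := ι))
    have hnorm : ‖c‖ = 1 := by
      have hdet : ‖U.det‖ = 1 := CStarRing.norm_of_mem_unitary (Matrix.det_of_mem_unitary hU)
      rwa [← pow_eq_one_iff_of_nonneg (norm_nonneg c) (Fintype.card_ne_zero (α := ι)),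
        ← norm_pow, hc]
    have hc0 : c ≠ 0 := norm_ne_zero_iff.1 (hnorm ▸ one_ne_zero)
    have hmem : c⁻¹ • U ∈ Matrix.specialUnitaryGroup ι ℂ := by
      refine Matrix.mem_specialUnitaryGroup_iff.2 ⟨?_, ?_⟩
      · have hstar : star c⁻¹ * c⁻¹ = 1 := by
          rw [Complex.star_def, Complex.conj_mul', norm_inv, hnorm]
          simp
        rw [Matrix.mem_unitaryGroup_iff', star_smul, Matrix.smul_mul, Matrix.mul_smul, smul_smul,
          hstar, one_smul]
        exact Matrix.mem_unitaryGroup_iff'.1 hU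
      · rw [Matrix.det_smul, inv_pow, hc, inv_mul_cancel₀]
        exact hc ▸ pow_ne_zero _ hc0
    exact ⟨c, ⟨_, hmem⟩, by rw [smul_smul, mul_inv_cancel₀ hc0, one_smul]⟩

end UnitaryTrick

/-! ### Schur–Weyl duality -/

section SchurWeyl

theorem exists_perm_of_sum_single_eq {κ ι : Type*} [Fintype ι] {f g : ι → κ}
    (h : ∑ i, Finsupp.single (f i) 1 = ∑ i, Finsupp.single (g i) (1 : ℕ)) :
    ∃ σ : Equiv.Perm ι, f = g ∘ σ := by
  classical
  have hcard (k : κ) : Fintype.card {i // f i = k} = Fintype.card {i // g i = k} := by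
    simpa [Finsupp.finsetSum_apply, Finsupp.single_apply, Fintype.card_subtype]
      using DFunLike.congr_fun h k
  exact ⟨Equiv.ofFiberEquiv fun k => Fintype.equivOfCardEq (hcard k),
    funext fun i => (Equiv.ofFiberEquiv_map _ i).symm⟩

theorem sum_mul_eq_zero_of_sum_monomial_eq_zero {κ τ R : Type*} [Fintype κ] [CommSemiring R]
    {e : κ → τ →₀ ℕ} {m c : κ → R} (hm : m.FactorsThrough e)
    (hc : ∑ p, MvPolynomial.monomial (e p) (c p) = 0) : ∑ p, m p * c p = 0 := by
  obtain ⟨f, rfl⟩ := (Function.factorsThrough_iff m).1 hm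
  have hmonomial (k : τ →₀ ℕ) (r : R) :
      (MvPolynomial.basisMonomials τ R).constr R f (MvPolynomial.monomial k r) = r * f k := by
    have hr : MvPolynomial.monomial k r = r • MvPolynomial.basisMonomials τ R k := by
      simp [MvPolynomial.smul_monomial]
    rw [hr, map_smul, Module.Basis.constr_basis, smul_eq_mul]
  simpa only [map_sum, hmonomial, map_zero, mul_comm, Function.comp_apply] using
    congrArg ((MvPolynomial.basisMonomials τ R).constr R f) hc

theorem dual_apply_eq_sum {κ R E : Type*} [Fintype κ] [DecidableEq κ] [CommRing R]
    [AddCommGroup E] [Module R E] (b : Module.Basis κ R E) (L : Module.Dual R (Module.End R E))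
    (T : Module.End R E) : L T = ∑ p : κ × κ, b.repr (T (b p.2)) p.1 * L (b.linearMap b p) := by
  have hT : T = ∑ p : κ × κ, b.repr (T (b p.2)) p.1 • b.linearMap b p := b.ext fun k => by
    simp [Module.Basis.linearMap_apply_apply, Fintype.sum_prod_type, b.sum_repr]
  conv_lhs => rw [hT]
  simp only [map_sum, map_smul, smul_eq_mul]

variable {N n : ℕ}

/-- The operator `X ⊗ ⋯ ⊗ X` on `V^{⊗ n}`, for an arbitrary matrix `X`. -/
def tensorPow (n : ℕ) (X : Matrix (Fin N) (Fin N) ℂ) : Module.End ℂ (VPow N n) :=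
  PiTensorProduct.map fun _ : Fin n => Matrix.toEuclideanLin X

theorem tensorPow_tprod (X : Matrix (Fin N) (Fin N) ℂ) (v : Fin n → V N) :
    tensorPow n X (PiTensorProduct.tprod ℂ v) =
      PiTensorProduct.tprod ℂ fun i => Matrix.toEuclideanLin X (v i) :=
  PiTensorProduct.map_tprod _ _

theorem commute_permRep_tensorPow (σ : Equiv.Perm (Fin n)) (X : Matrix (Fin N) (Fin N) ℂ) :
    Commute (permRep N n σ) (tensorPow n X) := by
  refine PiTensorProduct.ext (MultilinearMap.ext fun v => ?_)
  change permRep N n σ (tensorPow n X (PiTensorProduct.tprod ℂ v)) =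
    tensorPow n X (permRep N n σ (PiTensorProduct.tprod ℂ v))
  rw [permRep_tprod, tensorPow_tprod, tensorPow_tprod, permRep_tprod]

theorem tensorPow_smul (c : ℂ) (X : Matrix (Fin N) (Fin N) ℂ) :
    tensorPow n (c • X) = c ^ n • tensorPow n X := by
  refine PiTensorProduct.ext (MultilinearMap.ext fun v => ?_)
  change tensorPow n (c • X) (PiTensorProduct.tprod ℂ v) =
    c ^ n • tensorPow n X (PiTensorProduct.tprod ℂ v)
  simp only [tensorPow_tprod, map_smul, LinearMap.smul_apply]
  rw [MultilinearMap.map_smul_univ, Finset.prod_const, Finset.card_univ, Fintype.card_fin]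

theorem stdBasis_repr_tensorPow (X : Matrix (Fin N) (Fin N) ℂ) (a b : Fin n → Fin N) :
    (stdBasis N n).repr (tensorPow n X (stdBasis N n b)) a = ∏ i, X (a i) (b i) := by
  rw [stdBasis_apply, tensorPow_tprod, stdBasis, Basis.piTensorProduct_repr_tprod_apply]
  exact Finset.prod_congr rfl fun i _ => by simp [Matrix.toLpLin_apply]

theorem stdBasis_repr_apply_comp_perm {T : Module.End ℂ (VPow N n)}
    (hT : ∀ σ, Commute (permRep N n σ) T) (σ : Equiv.Perm (Fin n)) (a b : Fin n → Fin N) :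
    (stdBasis N n).repr (T (stdBasis N n (b ∘ σ))) (a ∘ σ) =
      (stdBasis N n).repr (T (stdBasis N n b)) a := by
  have hb : permRep N n σ (stdBasis N n (b ∘ σ)) = stdBasis N n b := by
    rw [permRep_stdBasis]
    exact congrArg _ (funext fun i => by simp)
  rw [← stdBasis_repr_permRep, ← Module.End.mul_apply, (hT σ).eq, Module.End.mul_apply, hb]

/-- The polynomial function `X ↦ L (X ⊗ ⋯ ⊗ X)` of the matrix entries, for a linear functional `L`
on the operators of `V^{⊗ n}`; see `eval_dualPoly`. -/
def dualPoly (L : Module.Dual ℂ (Module.End ℂ (VPow N n))) : MvPolynomial (Fin N × Fin N) ℂ :=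
  ∑ p : (Fin n → Fin N) × (Fin n → Fin N),
    MvPolynomial.monomial (∑ i, Finsupp.single (p.1 i, p.2 i) 1)
      (L ((stdBasis N n).linearMap (stdBasis N n) p))

theorem eval_dualPoly (L : Module.Dual ℂ (Module.End ℂ (VPow N n)))
    (X : Matrix (Fin N) (Fin N) ℂ) :
    MvPolynomial.eval (fun q => X q.1 q.2) (dualPoly L) = L (tensorPow n X) := by
  rw [dual_apply_eq_sum (stdBasis N n), dualPoly, map_sum]
  refine Finset.sum_congr rfl fun p _ => ?_
  rw [MvPolynomial.monomial_sum_index, stdBasis_repr_tensorPow, map_mul, MvPolynomial.eval_C,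
    map_prod, mul_comm]
  simp [MvPolynomial.eval_monomial]

theorem apply_eq_zero_of_dualPoly_eq_zero {L : Module.Dual ℂ (Module.End ℂ (VPow N n))}
    (hL : dualPoly L = 0) {T : Module.End ℂ (VPow N n)}
    (hT : ∀ σ, Commute (permRep N n σ) T) : L T = 0 := by
  rw [dual_apply_eq_sum (stdBasis N n)]
  refine sum_mul_eq_zero_of_sum_monomial_eq_zero (fun p q hpq => ?_) hL
  obtain ⟨σ, hσ⟩ := exists_perm_of_sum_single_eq hpq
  have hfst : p.1 = q.1 ∘ σ := funext fun i => congrArg Prod.fst (congrFun hσ i)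
  have hsnd : p.2 = q.2 ∘ σ := funext fun i => congrArg Prod.snd (congrFun hσ i)
  rw [hfst, hsnd, stdBasis_repr_apply_comp_perm hT]

theorem mem_span_range_suRep {T : Module.End ℂ (VPow N n)}
    (hT : ∀ σ, Commute (permRep N n σ) T) : T ∈ Submodule.span ℂ (Set.range (suRep N n)) := by
  by_contra hnot
  obtain ⟨L, hLT, hker⟩ := Submodule.exists_le_ker_of_notMem hnot
  have hSU (g : Matrix.specialUnitaryGroup (Fin N) ℂ) : L (tensorPow n g.1) = 0 :=
    hker (Submodule.subset_span ⟨g, rfl⟩)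
  refine hLT (apply_eq_zero_of_dualPoly_eq_zero (eq_zero_of_forall_unitary fun U hU => ?_) hT)
  obtain ⟨c, g, rfl⟩ := exists_eq_smul_specialUnitary hU
  rw [eval_dualPoly, tensorPow_smul, map_smul, hSU, smul_zero]

theorem apply_mem_of_commute (W : Subrepresentation (suRep N n)) {T : Module.End ℂ (VPow N n)}
    (hT : ∀ σ, Commute (permRep N n σ) T) {u : VPow N n} (hu : u ∈ W) : T u ∈ W := by
  have hle : Submodule.span ℂ (Set.range (suRep N n)) ≤
      Submodule.compatibleMaps W.toSubmodule W.toSubmodule := by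
    rw [Submodule.span_le]
    rintro _ ⟨g, rfl⟩
    exact W.apply_mem_toSubmodule g
  exact hle (mem_span_range_suRep hT) hu

end SchurWeyl

/-! ### Irreducibility -/

section Commutant

variable {K G E : Type*} [Field K] [Group G] [AddCommGroup E] [Module K E]
  {ρ : Representation K G E}

theorem eq_sum_unitCoeff [Fintype G] (x : MonoidAlgebra K G) :
    x = ∑ g, unitCoeff K G (single g⁻¹ 1 * x) • single g 1 := by
  classical
  induction x using MonoidAlgebra.induction_linear with
  | zero => simp
  | add x y hx hy =>
    simp only [mul_add, map_add, add_smul, Finset.sum_add_distrib]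
    rw [← hx, ← hy]
  | single h c => simp [single_mul_single, unitCoeff_single, inv_mul_eq_one]

theorem sum_inv_mul_ne_zero [Fintype G] {e : MonoidAlgebra K G} (he : IsIdempotentElem e)
    (h0 : e ≠ 0) {c : G → K} (hc : ∀ g, e * single g 1 * e = c g • e) : ∑ g, c g⁻¹ * c g ≠ 0 := by
  have hcoeff (g : G) : unitCoeff K G (single g⁻¹ 1 * e) = unitCoeff K G e * c g⁻¹ :=
    calc unitCoeff K G (single g⁻¹ 1 * e) = unitCoeff K G (single g⁻¹ 1 * e * e) := by
          rw [mul_assoc, he.eq]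
      _ = unitCoeff K G e * c g⁻¹ := by
          rw [unitCoeff_mul_comm, ← mul_assoc, hc, map_smul, smul_eq_mul, mul_comm]
  intro hsum
  refine h0 ?_
  calc e = e * e * e := by rw [he.eq, he.eq]
    _ = e * (∑ g, (unitCoeff K G e * c g⁻¹) • single g 1) * e := by
      simp only [← hcoeff]
      rw [← eq_sum_unitCoeff]
    _ = (unitCoeff K G e * ∑ g, c g⁻¹ * c g) • e := by
      simp only [Finset.mul_sum, Finset.sum_mul, mul_smul_comm, smul_mul_assoc, hc, smul_smul,
        Finset.sum_smul, mul_assoc]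
    _ = 0 := by rw [hsum, mul_zero, zero_smul]

theorem commute_sum_conj [Fintype G] (T : Module.End K E) (h : G) :
    Commute (ρ h) (∑ g, ρ g * T * ρ g⁻¹) := by
  rw [commute_iff_eq, Finset.mul_sum, Finset.sum_mul]
  refine Fintype.sum_equiv (Equiv.mulLeft h) _ _ fun g => ?_
  simp only [Equiv.coe_mulLeft, mul_inv_rev, map_mul, mul_assoc]
  rw [← map_mul ρ h⁻¹ h, inv_mul_cancel, map_one, mul_one]

-- The operator is a multiple of the average of a rank one operator over the group.
theorem exists_commute_apply_eq [Finite G] {e : MonoidAlgebra K G} (he : IsIdempotentElem e)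
    (hscalar : ∀ x, ∃ c : K, e * x * e = c • e) {u w : E} (hu0 : u ≠ 0)
    (hu : ρ.asAlgebraHom e u = u) (hw : ρ.asAlgebraHom e w = w) :
    ∃ T : Module.End K E, (∀ g, Commute (ρ g) T) ∧ T u = w := by
  have := Fintype.ofFinite G
  have h0 : e ≠ 0 := fun h => hu0 (by rw [← hu, h, map_zero, LinearMap.zero_apply])
  choose c hc using fun g => hscalar (single g 1)
  have hscale {v : E} (hv : ρ.asAlgebraHom e v = v) (g : G) :
      ρ.asAlgebraHom e (ρ g v) = c g • v := by
    simpa [hv] using congrArg (ρ.asAlgebraHom · v) (hc g)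
  obtain ⟨φ, hφ⟩ := Module.Projective.exists_dual_eq_one K hu0
  let S : Module.End K E := ∑ g, ρ g * (φ ∘ₗ ρ.asAlgebraHom e).smulRight w * ρ g⁻¹
  have hS (g : G) : Commute (ρ g) S := commute_sum_conj _ g
  have hSu : S u = ∑ g, c g⁻¹ • ρ g w := by
    simp only [S, LinearMap.sum_apply, Module.End.mul_apply, LinearMap.smulRight_apply,
      LinearMap.comp_apply, hscale hu, map_smul, hφ, smul_eq_mul, mul_one]
  have heS : S u = (∑ g, c g⁻¹ * c g) • w :=
    calc S u = ρ.asAlgebraHom e (S u) := by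
          rw [← Module.End.mul_apply, (commute_asAlgebraHom hS e).eq, Module.End.mul_apply, hu]
      _ = _ := by simp only [hSu, map_sum, map_smul, hscale hw, smul_smul, Finset.sum_smul]
  exact ⟨(∑ g, c g⁻¹ * c g)⁻¹ • S, fun g => (hS g).smul_right _, by
    rw [LinearMap.smul_apply, heS, inv_smul_smul₀ (sum_inv_mul_ne_zero he h0 hc)]⟩

end Commutant

theorem isIrreducible_toRepresentation {K G E : Type*} [Field K] [Monoid G] [AddCommGroup E]
    [Module K E] {ρ : Representation K G E} {U : Subrepresentation ρ} (hU : U ≠ ⊥)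
    (hmin : ∀ W : Subrepresentation ρ, W ≤ U → W ≠ ⊥ → U ≤ W) :
    U.toRepresentation.IsIrreducible := by
  have hnt : Nontrivial (Subrepresentation U.toRepresentation) := by
    refine ⟨⊥, ⊤, fun h => hU (Subrepresentation.toSubmodule_injective ?_)⟩
    refine Submodule.subsingleton_iff_eq_bot.1 ?_
    exact (Submodule.subsingleton_iff K).1 (subsingleton_of_bot_eq_top
      (congrArg Subrepresentation.toSubmodule h))
  refine { toNontrivial := hnt, eq_bot_or_eq_top := fun S => ?_ }
  let W : Subrepresentation ρ :=
    { toSubmodule := S.toSubmodule.map U.toSubmodule.subtype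
      apply_mem_toSubmodule := by
        rintro g _ ⟨v, hv, rfl⟩
        exact ⟨_, S.apply_mem_toSubmodule g hv, rfl⟩ }
  by_cases hW : W = ⊥
  · refine .inl (Subrepresentation.toSubmodule_injective ?_)
    exact Submodule.map_injective_of_injective U.toSubmodule.injective_subtype
      ((congrArg Subrepresentation.toSubmodule hW).trans (Submodule.map_bot _).symm)
  · refine .inr (Subrepresentation.toSubmodule_injective (Submodule.eq_top_iff'.2 fun v => ?_))
    obtain ⟨v', hv', hvv'⟩ := hmin W (Submodule.map_subtype_le _ _) hW v.2
    rwa [← Subtype.ext hvv']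

section Irreducibility

variable {N n : ℕ} {Θ : StandardTableau n}

variable (N Θ) in
/-- The image of `P_Θ`, as a subrepresentation of the product representation of `SU(N)`. -/
def projRange : Subrepresentation (suRep N n) where
  toSubmodule := LinearMap.range (P N Θ)
  apply_mem_toSubmodule g := by
    rintro _ ⟨v, rfl⟩
    refine ⟨suRep N n g v, ?_⟩
    rw [P_eq_algRep]
    exact LinearMap.congr_fun
      (commute_asAlgebraHom (fun σ => commute_permRep_tensorPow σ g.1) Θ.hermitianIdempotent).eq v

theorem algRep_hermitianIdempotent_apply {v : VPow N n} (hv : v ∈ projRange N Θ) :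
    algRep N n Θ.hermitianIdempotent v = v := by
  obtain ⟨w, rfl⟩ := hv
  rw [← P_eq_algRep, ← Module.End.mul_apply, ((orthogonalIdempotents_P N n).idem Θ).eq]

theorem projRange_eq_bot_iff : projRange N Θ = ⊥ ↔ P N Θ = 0 := by
  rw [← LinearMap.range_eq_bot, ← Subrepresentation.toSubmodule_injective.eq_iff]
  rfl

theorem projRange_le_of_ne_bot {W : Subrepresentation (suRep N n)} (hW : W ≤ projRange N Θ)
    (hne : W ≠ ⊥) : projRange N Θ ≤ W := by
  obtain ⟨u, hu, hu0⟩ := Submodule.exists_mem_ne_zero_of_ne_bot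
    (Subrepresentation.toSubmodule_injective.ne hne)
  intro w hw
  obtain ⟨T, hT, rfl⟩ := exists_commute_apply_eq Θ.isIdempotentElem_hermitianIdempotent
    Θ.exists_hermitianIdempotent_mul_mul hu0 (algRep_hermitianIdempotent_apply (hW hu))
    (algRep_hermitianIdempotent_apply hw)
  exact apply_mem_of_commute W hT hu

theorem isIrreducible_projRange (h : Θ.numRows ≤ N) :
    (projRange N Θ).toRepresentation.IsIrreducible :=
  isIrreducible_toRepresentation (projRange_eq_bot_iff.not.2 (P_ne_zero h))
    fun _ => projRange_le_of_ne_bot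

end Irreducibility

end HermitianYoung

end

theorem theorem1 (N n : ℕ) (hn : 2 ≤ n) :
    -- transversality
    (∀ Θ Φ : HermitianYoung.StandardTableau n,
      HermitianYoung.P N Θ * HermitianYoung.P N Φ =
        if Θ = Φ then HermitianYoung.P N Θ else 0) ∧
    -- dimension
    (∀ Θ : HermitianYoung.StandardTableau n,
      LinearMap.trace ℂ (HermitianYoung.VPow N n) (HermitianYoung.P N Θ) =
        LinearMap.trace ℂ (HermitianYoung.VPow N n) (HermitianYoung.Y N Θ)) ∧
    -- completeness
    (∑ Θ : HermitianYoung.StandardTableau n, HermitianYoung.P N Θ = 1) ∧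
    -- Hermiticity
    (∀ Θ : HermitianYoung.StandardTableau n,
      HermitianYoung.IsHermitianOp (HermitianYoung.P N Θ)) ∧
    -- orthogonal projectors onto invariant subspaces, which are irreducible if the tableau has
    -- at most `N` rows and zero otherwise
    (∀ Θ : HermitianYoung.StandardTableau n,
      ∃ U : Subrepresentation (HermitianYoung.suRep N n),
        LinearMap.range (HermitianYoung.P N Θ) = U.toSubmodule ∧
        HermitianYoung.IsOrthogonalProjectorOnto (HermitianYoung.P N Θ) U.toSubmodule ∧
        (Θ.numRows ≤ N → U.toRepresentation.IsIrreducible) ∧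
        (N < Θ.numRows → U = ⊥)) := by
  refine ⟨fun Θ Φ => (HermitianYoung.orthogonalIdempotents_P N n).mul_eq Θ Φ,
    HermitianYoung.trace_P N, HermitianYoung.sum_P N n, HermitianYoung.isHermitianOp_P N,
    fun Θ => ⟨HermitianYoung.projRange N Θ, rfl, ?_, HermitianYoung.isIrreducible_projRange,
      fun h => HermitianYoung.projRange_eq_bot_iff.2 (HermitianYoung.P_eq_zero h)⟩⟩
  exact HermitianYoung.isOrthogonalProjectorOnto_range (HermitianYoung.isHermitianOp_P N Θ)
    ((HermitianYoung.orthogonalIdempotents_P N n).idem Θ)
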